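/- Let $n\ge 1$, $s\in(0,1)$ and $0<p<2^*-2$, where $2^*=\frac{2n}{n-2}$ if $n>2$ and $2^*=+\infty$ if $n\in\{1,2\}$; all functions are real-valued. On $H^1(\mathbb{R}^n)=\{u\in L^2(\mathbb{R}^n):\int(1+|\xi|^2)|\hat u|^2\,d\xi<\infty\}$, with $\hat u$ the unitary Fourier transform, put $$\langle u,v\rangle_s=\int_{\mathbb{R}^n}(1+|\xi|^2+|\xi|^{2s})\,\hat u(\xi)\overline{\hat v(\xi)}\,d\xi,\qquad \|u\|_s^2=\langle u,u\rangle_s,$$ $$J_s(v)=\frac{\|v\|_s^2}{\left(\int_{\mathbb{R}^n}|v|^{p+2}\,dx\right)^{2/(p+2)}},\qquad \lambda_s=\inf_{v\in H^1(\mathbb{R}^n)\setminus\{0\}}J_s(v).$$ Let $u_s\in H^1(\mathbb{R}^n)$ be a ground state of $-\Delta u+(-\Delta)^su+u=u^{p+1}$, i.e. $u_s\ge 0$, $u_s\not\equiv 0$, $\langle u_s,\varphi\rangle_s=\int_{\mathbb{R}^n}u_s^{p+1}\varphi\,dx$ for all $\varphi\in H^1(\mathbb{R}^n)$, and $J_s(u_s)=\lambda_s$.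 Let $$L_s=-\Delta+(-\Delta)^s+1-(p+1)u_s^p$$ be the linearized operator, i.e. the self-adjoint operator on $L^2(\mathbb{R}^n)$ associated with the quadratic form $Q_s(\varphi)=\|\varphi\|_s^2-(p+1)\int_{\mathbb{R}^n}u_s^p\varphi^2\,dx$ with form domain $H^1(\mathbb{R}^n)$. Then: 1. $Q_s(u_s)<0$, and $Q_s(\varphi)\ge 0$ for every $\varphi\in H^1(\mathbb{R}^n)$ with $\langle u_s,\varphi\rangle_s=0$. 2. $L_s$ has exactly one strictly negative eigenvalue, and this eigenvalue is simple; that is, the Morse index of $u_s$ (the number of negative eigenvalues of $L_s$ counted with multiplicity) equals $1$. 3. There is a point $x_0\in\mathbb{R}^n$ such that both $u_s$ and the eigenfunctions of $L_s$ for its negative eigenvalue are radial about $x_0$, i.e. functions of $|x-x_0|$ almost everywhere. -/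

import Mathlib

open MeasureTheory FourierTransform

noncomputable section

namespace MixedSchrodinger

/-- Euclidean space `ℝⁿ`. -/
abbrev Eucl (n : ℕ) : Type := EuclideanSpace ℝ (Fin n)

/-- The real Hilbert space `L²(ℝⁿ)` of (classes of) real-valued functions. -/
abbrev L2 (n : ℕ) : Type := Lp ℝ 2 (volume : Measure (Eucl n))

/-- The `L²` Fourier transform of a real-valued function, in Mathlib's unitary normalization
`(𝓕 u)(ξ) = ∫ exp (-2πi ξ·x) u x dx`. The angular frequency is therefore `2πξ`. -/
def fourier {n : ℕ} (u : L2 n) : Lp ℂ 2 (volume : Measure (Eucl n)) :=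
  𝓕 (Complex.ofRealCLM.compLp u : Lp ℂ 2 (volume : Measure (Eucl n)))

/-- `u ∈ H¹(ℝⁿ)`: the function `(1 + |η|²) |û|²` is integrable (`η = 2πξ`). -/
def MemH1 {n : ℕ} (u : L2 n) : Prop :=
  Integrable (fun ξ : Eucl n => (1 + (2 * Real.pi * ‖ξ‖) ^ 2) * ‖fourier u ξ‖ ^ 2)

/-- The Fourier symbol `1 + |η|² + |η|^{2s}`, `η = 2πξ`, of `-Δ + (-Δ)^s + 1`. -/
def symbol {n : ℕ} (s : ℝ) (ξ : Eucl n) : ℝ :=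
  1 + (2 * Real.pi * ‖ξ‖) ^ 2 + (2 * Real.pi * ‖ξ‖) ^ (2 * s)

/-- The scalar product `⟨u, v⟩_s = ∫ (1 + |η|² + |η|^{2s}) û(η) conj(v̂(η)) dη` on `H¹(ℝⁿ)`.
For real-valued `u`, `v` this integral is real, so only the real part is integrated. -/
def innerS {n : ℕ} (s : ℝ) (u v : L2 n) : ℝ :=
  ∫ ξ : Eucl n, symbol s ξ * (fourier u ξ * (starRingEnd ℂ) (fourier v ξ)).re

/-- The quotient `J_s(v) = ‖v‖_s² / (∫ |v|^{p+2})^{2/(p+2)}`. -/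
def J {n : ℕ} (s p : ℝ) (v : L2 n) : ℝ :=
  innerS s v v / (∫ x : Eucl n, |v x| ^ (p + 2)) ^ (2 / (p + 2))

/-- The infimum `λ_s` of `J_s` over `H¹(ℝⁿ) \ {0}`. -/
def lam (n : ℕ) (s p : ℝ) : ℝ :=
  sInf {t : ℝ | ∃ v : L2 n, MemH1 v ∧ v ≠ 0 ∧ J s p v = t}

/-- `u ∈ H¹(ℝⁿ)` is a weak solution of `-Δu + (-Δ)^s u + u = u^{p+1}`. -/
def IsWeakSolution {n : ℕ} (s p : ℝ) (u : L2 n) : Prop :=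
  MemH1 u ∧ ∀ φ : L2 n, MemH1 φ → innerS s u φ = ∫ x : Eucl n, u x ^ (p + 1) * φ x

/-- Ground states: nonnegative, nonzero weak solutions `u` with `J_s(u) = λ_s`. -/
structure IsGroundState {n : ℕ} (s p : ℝ) (u : L2 n) : Prop where
  solution : IsWeakSolution s p u
  nonneg : ∀ᵐ x : Eucl n, 0 ≤ u x
  ne_zero : u ≠ 0
  least_energy : J s p u = lam n s p

/-- The quadratic form, with form domain `H¹(ℝⁿ)`, of the linearized operator
`L_s = -Δ + (-Δ)^s + 1 - (p+1) u^p`, in polarized form. -/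
def linForm {n : ℕ} (s p : ℝ) (u φ ψ : L2 n) : ℝ :=
  innerS s φ ψ - (p + 1) * ∫ x : Eucl n, u x ^ p * (φ x * ψ x)

/-- `φ` belongs to the domain of `L_s` and `L_s φ = f`. Here `L_s` is the self-adjoint operator on
`L²(ℝⁿ)` associated with the form `linForm s p u` on `H¹(ℝⁿ)`: its domain consists of those
`φ ∈ H¹(ℝⁿ)` for which some `f ∈ L²(ℝⁿ)` represents `ψ ↦ linForm s p u φ ψ`,
and then `L_s φ = f`. -/
def LinearizedEq {n : ℕ} (s p : ℝ) (u φ f : L2 n) : Prop :=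
  MemH1 φ ∧ ∀ ψ : L2 n, MemH1 ψ → linForm s p u φ ψ = inner ℝ f ψ

/-- `φ` is an eigenfunction of `L_s` with eigenvalue `μ`. -/
def IsEigenfunction {n : ℕ} (s p : ℝ) (u : L2 n) (μ : ℝ) (φ : L2 n) : Prop :=
  φ ≠ 0 ∧ LinearizedEq s p u φ (μ • φ)

/-- `φ` is radial about the point `x₀`: it is a function of `|x - x₀|` almost everywhere. -/
def IsRadialAbout {n : ℕ} (x₀ : Eucl n) (φ : L2 n) : Prop :=
  ∃ g : ℝ → ℝ, ∀ᵐ x : Eucl n, φ x = g ‖x - x₀‖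

end MixedSchrodinger

end

open MeasureTheory FourierTransform Filter Topology
open scoped ENNReal NNReal

noncomputable section

namespace MixedSchrodinger

variable {n : ℕ}

lemma fourier_comp_add (f : Eucl n → ℂ) (z ξ : Eucl n) :
    𝓕 (f ∘ fun v => v + z) ξ = Complex.exp (↑(2 * Real.pi * inner ℝ z ξ) * Complex.I) * 𝓕 f ξ := by
  rw [Real.fourier_eq', Real.fourier_eq', ← integral_const_mul]
  refine Eq.trans ?_ (integral_add_right_eq_self (fun v : Eucl n =>
    Complex.exp (↑(2 * Real.pi * inner ℝ z ξ) * Complex.I) *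
      Complex.exp (↑(-2 * Real.pi * inner ℝ v ξ) * Complex.I) • f v) z)
  refine integral_congr_ae (ae_of_all _ fun v => ?_)
  simp only [Function.comp_apply, smul_eq_mul]
  rw [← mul_assoc, ← Complex.exp_add, inner_add_left]
  congr 2
  push_cast
  ring

/-- The Fourier transform turns translations into multiplication by characters. -/
lemma fourier_compMeasurePreserving_add (g : Lp ℂ 2 (volume : Measure (Eucl n))) (z : Eucl n) :
    (𝓕 (Lp.compMeasurePreserving (· + z) (measurePreserving_add_right volume z) g) :
      Lp ℂ 2 (volume : Measure (Eucl n))) =ᵐ[volume]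
      fun ξ => Complex.exp (↑(2 * Real.pi * inner ℝ z ξ) * Complex.I) * (𝓕 g : Lp ℂ 2 (volume : Measure (Eucl n))) ξ := by
  have hmem : MemLp (fun ξ : Eucl n => Complex.exp (↑(2 * Real.pi * inner ℝ z ξ) * Complex.I)) ∞ volume := by
    refine memLp_top_of_bound (C := 1) ?_ (ae_of_all _ fun ξ => (Complex.norm_exp_ofReal_mul_I _).le)
    exact Continuous.aestronglyMeasurable (by fun_prop)
  set B := (ContinuousLinearMap.mul ℂ ℂ).holderL (volume : Measure (Eucl n)) ∞ 2 2 with hB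
  have hBc : ∀ h : Lp ℂ 2 (volume : Measure (Eucl n)), B hmem.toLp h =ᵐ[volume]
      fun ξ => Complex.exp (↑(2 * Real.pi * inner ℝ z ξ) * Complex.I) * h ξ := by
    intro h
    filter_upwards [(ContinuousLinearMap.mul ℂ ℂ).coeFn_holder (r := 2) (hmem.toLp) h,
      hmem.coeFn_toLp] with ξ h1 h2
    change ((ContinuousLinearMap.mul ℂ ℂ).holder 2 (hmem.toLp) h) ξ = _
    rw [h1, h2]; rfl
  suffices hp : (𝓕 (Lp.compMeasurePreserving (· + z) (measurePreserving_add_right volume z) g) :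
      Lp ℂ 2 (volume : Measure (Eucl n))) = B hmem.toLp (𝓕 g) by
    rw [hp]; exact hBc _
  refine DenseRange.induction_on (p := fun g : Lp ℂ 2 (volume : Measure (Eucl n)) =>
    (𝓕 (Lp.compMeasurePreserving (· + z) (measurePreserving_add_right volume z) g) :
      Lp ℂ 2 (volume : Measure (Eucl n))) = B hmem.toLp (𝓕 g))
    (SchwartzMap.denseRange_toLpCLM (p := 2) (μ := volume) ENNReal.ofNat_ne_top) g ?_ ?_
  · apply isClosed_eq
    · exact (Lp.fourierTransformₗᵢ (Eucl n) ℂ).continuous.comp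
        (Lp.isometry_compMeasurePreserving (measurePreserving_add_right volume z)).continuous
    · exact (B hmem.toLp).continuous.comp (Lp.fourierTransformₗᵢ (Eucl n) ℂ).continuous
  · intro f
    change (𝓕 (Lp.compMeasurePreserving (· + z) (measurePreserving_add_right volume z)
      (f.toLp 2)) : Lp ℂ 2 (volume : Measure (Eucl n))) = B hmem.toLp (𝓕 (f.toLp 2))
    have h1 : Lp.compMeasurePreserving (· + z) (measurePreserving_add_right volume z) (f.toLp 2)
        = (f.compSubConstCLM ℂ (-z)).toLp 2 := by
      ext1
      have hq := (measurePreserving_add_right (volume : Measure (Eucl n)) z).quasiMeasurePreserving.ae_eq_comp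
        (f.coeFn_toLp 2 volume)
      filter_upwards [Lp.coeFn_compMeasurePreserving (f.toLp 2 volume)
        (measurePreserving_add_right volume z), hq,
        (f.compSubConstCLM ℂ (-z)).coeFn_toLp 2 volume] with x h1 h2 h3
      rw [h1, h2, h3]
      simp
    rw [h1, SchwartzMap.toLp_fourier_eq, SchwartzMap.toLp_fourier_eq]
    ext1
    filter_upwards [(𝓕 (f.compSubConstCLM ℂ (-z))).coeFn_toLp 2 volume,
      hBc ((𝓕 f).toLp 2), (𝓕 f).coeFn_toLp 2 volume] with ξ h2 h3 h4
    rw [h2, h3, h4, SchwartzMap.fourier_coe, SchwartzMap.fourier_coe]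
    have h6 : ((f.compSubConstCLM ℂ (-z) : SchwartzMap _ _) : Eucl n → ℂ) = f ∘ fun v => v + z := by
      ext x; simp
    rw [h6]
    exact fourier_comp_add f z ξ

/-- `L²` squared norm as a lower integral. -/
lemma lintegral_enorm_sq_eq {E : Type*} [NormedAddCommGroup E]
    (g : Lp E 2 (volume : Measure (Eucl n))) :
    ∫⁻ x, ‖g x‖ₑ ^ 2 = ‖g‖ₑ ^ 2 := by
  rw [Lp.enorm_def, eLpNorm_eq_lintegral_rpow_enorm_toReal (by norm_num) (by norm_num)]
  simp only [ENNReal.toReal_ofNat, ENNReal.rpow_ofNat, one_div]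
  rw [← ENNReal.rpow_natCast, ← ENNReal.rpow_mul]
  norm_num

lemma coeFn_ofReal (u : L2 n) :
    (Complex.ofRealCLM.compLp u : Lp ℂ 2 (volume : Measure (Eucl n))) =ᵐ[volume]
      fun x => (u x : ℂ) :=
  Complex.ofRealCLM.coeFn_compLp u

lemma fourier_add (u v : L2 n) : fourier (u + v) = fourier u + fourier v := by
  unfold fourier
  rw [← FourierTransform.fourier_add]
  congr 1
  exact (Complex.ofRealCLM.compLpL 2 (volume : Measure (Eucl n))).map_add u v

lemma fourier_smul (c : ℝ) (u : L2 n) : fourier (c • u) = (c : ℂ) • fourier u := by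
  unfold fourier
  rw [← FourierTransform.fourier_smul]
  congr 1
  rw [Complex.coe_smul]
  exact (Complex.ofRealCLM.compLpL 2 (volume : Measure (Eucl n))).map_smul c u

lemma norm_fourier (u : L2 n) : ‖fourier u‖ = ‖u‖ := by
  unfold fourier
  rw [Lp.norm_fourier_eq, Lp.norm_def, Lp.norm_def]
  congr 1
  refine eLpNorm_congr_norm_ae ?_
  filter_upwards [coeFn_ofReal u] with x hx
  rw [hx]; simp

/-- Plancherel's identity for the differences of translates. -/
lemma lintegral_sub_translate (u : L2 n) (z : Eucl n) :
    ∫⁻ x, ‖u (x + z) - u x‖ₑ ^ 2 =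
      ∫⁻ ξ, ‖Complex.exp (↑(2 * Real.pi * inner ℝ z ξ) * Complex.I) - 1‖ₑ ^ 2 * ‖fourier u ξ‖ₑ ^ 2 := by
  set g : Lp ℂ 2 (volume : Measure (Eucl n)) := Complex.ofRealCLM.compLp u with hg
  set T := Lp.compMeasurePreserving (· + z) (measurePreserving_add_right (volume : Measure (Eucl n)) z) g
    with hT
  have h1 : ∫⁻ x, ‖u (x + z) - u x‖ₑ ^ 2 = ∫⁻ x, ‖(T - g) x‖ₑ ^ 2 := by
    refine lintegral_congr_ae ?_
    have hq := (measurePreserving_add_right (volume : Measure (Eucl n)) z).quasiMeasurePreserving.ae_eq_comp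
        (coeFn_ofReal u)
    filter_upwards [Lp.coeFn_sub T g, Lp.coeFn_compMeasurePreserving g
        (measurePreserving_add_right volume z), hq, coeFn_ofReal u] with x h1 h2 h3 h4
    rw [h1, Pi.sub_apply, h2, h3, hg, h4]
    simp only [Function.comp_apply]
    rw [← Complex.ofReal_sub, ← ofReal_norm, ← ofReal_norm, Complex.norm_real]
  rw [h1, lintegral_enorm_sq_eq]
  have h2 : ‖T - g‖ₑ = ‖(𝓕 T - 𝓕 g : Lp ℂ 2 (volume : Measure (Eucl n)))‖ₑ := by
    rw [← ofReal_norm, ← ofReal_norm, ← (Lp.fourierTransformₗᵢ (Eucl n) ℂ).norm_map (T - g), map_sub]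
    rfl
  rw [h2, ← lintegral_enorm_sq_eq]
  refine lintegral_congr_ae ?_
  filter_upwards [Lp.coeFn_sub (𝓕 T : Lp ℂ 2 (volume : Measure (Eucl n))) (𝓕 g),
    fourier_compMeasurePreserving_add g z] with ξ h1 h2
  rw [h1, Pi.sub_apply, h2, ← mul_pow, ← enorm_mul]
  congr 2
  rw [sub_mul, one_mul]
  rfl

/-- The Gaussian interaction energy of the differences of `u`. -/
def heatEnergy (b : ℝ) (u : Eucl n → ℝ) : ℝ≥0∞ :=
  ∫⁻ x, ∫⁻ y, ENNReal.ofReal (Real.exp (-b * ‖x - y‖ ^ 2)) * ‖u x - u y‖ₑ ^ 2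

/-- The spectral form `∫ (1 - exp (-t |η|²)) |û|²` of `1 - exp (tΔ)`. -/
def heatSpec (t : ℝ) (u : L2 n) : ℝ≥0∞ :=
  ∫⁻ ξ, ENNReal.ofReal (1 - Real.exp (-t * (2 * Real.pi * ‖ξ‖) ^ 2)) * ‖fourier u ξ‖ₑ ^ 2

lemma measurable_coe (u : L2 n) : Measurable u := (Lp.stronglyMeasurable u).measurable

lemma measurable_fourier (u : L2 n) : Measurable (fourier u) :=
  (Lp.stronglyMeasurable (fourier u)).measurable

lemma norm_sq_exp_sub_one (θ : ℝ) :
    ‖Complex.exp (θ * Complex.I) - 1‖ ^ 2 = 2 - 2 * Real.cos θ := by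
  rw [Complex.exp_mul_I, ← Complex.normSq_eq_norm_sq, Complex.normSq_apply]
  simp [← Complex.ofReal_cos, ← Complex.ofReal_sin]
  nlinarith [Real.sin_sq_add_cos_sq θ]

lemma integrable_gaussian {b : ℝ} (hb : 0 < b) :
    Integrable (fun z : Eucl n => Real.exp (-b * ‖z‖ ^ 2)) := by
  have := GaussianFourier.integral_rexp_neg_mul_sq_norm (V := Eucl n) hb
  by_contra h
  rw [integral_undef h] at this
  have : (0 : ℝ) < (Real.pi / b) ^ (Module.finrank ℝ (Eucl n) / 2 : ℝ) := by positivity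
  linarith

lemma integral_gaussian_cos {b : ℝ} (hb : 0 < b) (ξ : Eucl n) :
    ∫ z : Eucl n, Real.exp (-b * ‖z‖ ^ 2) * Real.cos (2 * Real.pi * inner ℝ z ξ) =
      (Real.pi / b) ^ ((n : ℝ) / 2) * Real.exp (-Real.pi ^ 2 * ‖ξ‖ ^ 2 / b) := by
  have h := GaussianFourier.integral_cexp_neg_mul_sq_norm_add (V := Eucl n)
    (b := (b : ℂ)) (by simpa using hb) (2 * Real.pi * Complex.I) ξ
  have h2 := congrArg Complex.re h
  have hR : ((Real.pi : ℂ) / b) ^ (Module.finrank ℝ (Eucl n) / 2 : ℂ) *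
      Complex.exp ((2 * Real.pi * Complex.I) ^ 2 * ‖ξ‖ ^ 2 / (4 * b)) =
      (((Real.pi / b) ^ ((n : ℝ) / 2) * Real.exp (-Real.pi ^ 2 * ‖ξ‖ ^ 2 / b) : ℝ) : ℂ) := by
    rw [Complex.ofReal_mul, Complex.ofReal_cpow (by positivity), Complex.ofReal_exp]
    congr 1
    · simp
    · congr 1
      rw [mul_pow, Complex.I_sq]
      push_cast
      field_simp
      ring
  rw [hR, Complex.ofReal_re] at h2
  rw [← h2]
  have hre := integral_re (𝕜 := ℂ) (μ := volume) (f := fun v : Eucl n =>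
    Complex.exp (-(b : ℂ) * ‖v‖ ^ 2 + 2 * Real.pi * Complex.I * inner ℝ ξ v)) ?_
  · rw [show (∫ v : Eucl n, Complex.exp (-(b : ℂ) * ‖v‖ ^ 2 + 2 * Real.pi * Complex.I * inner ℝ ξ v)).re
      = _ from hre.symm]
    refine integral_congr_ae (ae_of_all _ fun v => ?_)
    simp only [RCLike.re_eq_complex_re]
    rw [Complex.exp_re]
    have e1 : (-(b : ℂ) * ‖v‖ ^ 2 + 2 * Real.pi * Complex.I * inner ℝ ξ v) =
      ((-b * ‖v‖ ^ 2 : ℝ) : ℂ) + ((2 * Real.pi * inner ℝ v ξ : ℝ) : ℂ) * Complex.I := by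
      rw [real_inner_comm]; push_cast; ring
    rw [e1, Complex.add_re, Complex.add_im, Complex.re_ofReal_mul, Complex.im_ofReal_mul]
    simp only [Complex.ofReal_re, Complex.ofReal_im, Complex.I_re, Complex.I_im]
    simp
  · by_contra hni
    rw [integral_undef hni] at h
    rw [hR] at h
    have : (0 : ℝ) < ((Real.pi / b) ^ ((n : ℝ) / 2) * Real.exp (-Real.pi ^ 2 * ‖ξ‖ ^ 2 / b) : ℝ) := by
      positivity
    rw [← Complex.ofReal_zero, Complex.ofReal_inj] at h
    linarith

lemma lintegral_gaussian_character {b : ℝ} (hb : 0 < b) (ξ : Eucl n) :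
    ∫⁻ z : Eucl n, ENNReal.ofReal (Real.exp (-b * ‖z‖ ^ 2)) *
      ‖Complex.exp (↑(2 * Real.pi * inner ℝ z ξ) * Complex.I) - 1‖ₑ ^ 2 =
      ENNReal.ofReal (2 * (Real.pi / b) ^ ((n : ℝ) / 2)) *
        ENNReal.ofReal (1 - Real.exp (-(1 / (4 * b)) * (2 * Real.pi * ‖ξ‖) ^ 2)) := by
  have hint : Integrable (fun z : Eucl n =>
      Real.exp (-b * ‖z‖ ^ 2) * Real.cos (2 * Real.pi * inner ℝ z ξ)) := by
    refine (integrable_gaussian hb).mul_bdd (c := 1) ?_ ?_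
    · exact Continuous.aestronglyMeasurable (by fun_prop)
    · exact ae_of_all _ fun z => by simpa using Real.abs_cos_le_one _
  have h1 : ∀ z : Eucl n, ENNReal.ofReal (Real.exp (-b * ‖z‖ ^ 2)) *
      ‖Complex.exp (↑(2 * Real.pi * inner ℝ z ξ) * Complex.I) - 1‖ₑ ^ 2 =
      ENNReal.ofReal (2 * Real.exp (-b * ‖z‖ ^ 2) -
        2 * (Real.exp (-b * ‖z‖ ^ 2) * Real.cos (2 * Real.pi * inner ℝ z ξ))) := by
    intro z
    rw [← ofReal_norm, ← ENNReal.ofReal_pow (norm_nonneg _), norm_sq_exp_sub_one,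
      ← ENNReal.ofReal_mul (Real.exp_nonneg _)]
    congr 1; ring
  simp_rw [h1]
  rw [← ofReal_integral_eq_lintegral_ofReal]
  · rw [integral_sub ((integrable_gaussian hb).const_mul 2) (hint.const_mul 2),
      integral_const_mul, integral_const_mul, integral_gaussian_cos hb,
      GaussianFourier.integral_rexp_neg_mul_sq_norm hb, ← ENNReal.ofReal_mul (by positivity)]
    congr 1
    rw [show -(1 / (4 * b)) * (2 * Real.pi * ‖ξ‖) ^ 2 = -Real.pi ^ 2 * ‖ξ‖ ^ 2 / b by
      field_simp; ring]
    simp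
    ring
  · exact ((integrable_gaussian hb).const_mul 2).sub (hint.const_mul 2)
  · refine ae_of_all _ fun z => ?_
    have := Real.cos_le_one (2 * Real.pi * inner ℝ z ξ)
    have h2 := Real.exp_nonneg (-b * ‖z‖ ^ 2)
    simp only [Pi.zero_apply]
    nlinarith

lemma heatEnergy_eq {b : ℝ} (hb : 0 < b) (u : L2 n) :
    heatEnergy b u = ENNReal.ofReal (2 * (Real.pi / b) ^ ((n : ℝ) / 2)) *
      heatSpec (1 / (4 * b)) u := by
  have hu := measurable_coe u
  have hf := measurable_fourier u
  unfold heatEnergy heatSpec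
  calc ∫⁻ x, ∫⁻ y, ENNReal.ofReal (Real.exp (-b * ‖x - y‖ ^ 2)) * ‖u x - u y‖ₑ ^ 2
      = ∫⁻ x, ∫⁻ z, ENNReal.ofReal (Real.exp (-b * ‖z‖ ^ 2)) * ‖u (x + z) - u x‖ₑ ^ 2 := by
        refine lintegral_congr fun x => ?_
        rw [← lintegral_add_left_eq_self (μ := volume) _ x]
        refine lintegral_congr fun z => ?_
        rw [enorm_sub_rev]
        simp
    _ = ∫⁻ z, ∫⁻ x, ENNReal.ofReal (Real.exp (-b * ‖z‖ ^ 2)) * ‖u (x + z) - u x‖ₑ ^ 2 := by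
        refine lintegral_lintegral_swap (Measurable.aemeasurable ?_)
        fun_prop
    _ = ∫⁻ z, ∫⁻ ξ, ENNReal.ofReal (Real.exp (-b * ‖z‖ ^ 2)) *
          (‖Complex.exp (↑(2 * Real.pi * inner ℝ z ξ) * Complex.I) - 1‖ₑ ^ 2 *
            ‖fourier u ξ‖ₑ ^ 2) := by
        refine lintegral_congr fun z => ?_
        rw [lintegral_const_mul _ (by fun_prop), lintegral_const_mul _ (by fun_prop),
          lintegral_sub_translate]
    _ = ∫⁻ ξ, ∫⁻ z, ENNReal.ofReal (Real.exp (-b * ‖z‖ ^ 2)) *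
          (‖Complex.exp (↑(2 * Real.pi * inner ℝ z ξ) * Complex.I) - 1‖ₑ ^ 2 *
            ‖fourier u ξ‖ₑ ^ 2) := by
        refine lintegral_lintegral_swap (Measurable.aemeasurable ?_)
        fun_prop
    _ = _ := by
        rw [← lintegral_const_mul _ (by fun_prop)]
        refine lintegral_congr fun ξ => ?_
        simp_rw [← mul_assoc]
        rw [lintegral_mul_const _ (by fun_prop), lintegral_gaussian_character hb]

lemma heatSpec_ne_top {t : ℝ} (u : L2 n) : heatSpec t u ≠ ∞ := by
  refine ne_top_of_le_ne_top ?_ (lintegral_mono (g := fun ξ => ‖fourier u ξ‖ₑ ^ 2) fun ξ => ?_)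
  · rw [lintegral_enorm_sq_eq]; simp
  · refine mul_le_of_le_one_left' ?_
    rw [ENNReal.ofReal_le_one]
    linarith [Real.exp_nonneg (-t * (2 * Real.pi * ‖ξ‖) ^ 2)]

lemma heatEnergy_ne_top {b : ℝ} (hb : 0 < b) (u : L2 n) : heatEnergy b u ≠ ∞ := by
  rw [heatEnergy_eq hb]
  exact ENNReal.mul_ne_top ENNReal.ofReal_ne_top (heatSpec_ne_top u)

lemma heatSpec_le_iff {b : ℝ} (hb : 0 < b) (u v : L2 n) :
    heatEnergy b v ≤ heatEnergy b u ↔ heatSpec (1 / (4 * b)) v ≤ heatSpec (1 / (4 * b)) u := by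
  rw [heatEnergy_eq hb, heatEnergy_eq hb]
  refine ENNReal.mul_le_mul_iff_right ?_ ENNReal.ofReal_ne_top
  rw [Ne, ENNReal.ofReal_eq_zero, not_le]
  positivity

/-- The local part `∫ |η|² |û|²` of the energy. -/
def gradEnergy (u : L2 n) : ℝ≥0∞ :=
  ∫⁻ ξ, ENNReal.ofReal ((2 * Real.pi * ‖ξ‖) ^ 2) * ‖fourier u ξ‖ₑ ^ 2

/-- The nonlocal part `∫ |η|^{2s} |û|²` of the energy. -/
def fracEnergy (s : ℝ) (u : L2 n) : ℝ≥0∞ :=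
  ∫⁻ ξ, ENNReal.ofReal ((2 * Real.pi * ‖ξ‖) ^ (2 * s)) * ‖fourier u ξ‖ₑ ^ 2

lemma one_sub_exp_le (x : ℝ) : 1 - Real.exp (-x) ≤ x := by
  linarith [Real.add_one_le_exp (-x)]

lemma tendsto_mul_one_sub_exp (x : ℝ) :
    Tendsto (fun k : ℕ => ((k : ℝ) + 1) * (1 - Real.exp (-(1 / ((k : ℝ) + 1)) * x))) atTop (𝓝 x) := by
  have h : HasDerivAt (fun t : ℝ => 1 - Real.exp (-t * x)) x 0 := by
    have := ((hasDerivAt_id (0 : ℝ)).neg.mul_const x).exp.const_sub 1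
    simpa using this
  have h2 := h.tendsto_slope_zero_right
  have h3 : Tendsto (fun k : ℕ => 1 / ((k : ℝ) + 1)) atTop (𝓝[>] 0) := by
    refine tendsto_nhdsWithin_iff.2 ⟨tendsto_one_div_add_atTop_nhds_zero_nat, ?_⟩
    exact Eventually.of_forall fun k => by simp only [Set.mem_Ioi]; positivity
  refine (h2.comp h3).congr fun k => ?_
  simp

lemma gradEnergy_mono {u v : L2 n} (h : ∀ t > 0, heatSpec t v ≤ heatSpec t u) :
    gradEnergy v ≤ gradEnergy u := by
  have hv := measurable_fourier v
  calc gradEnergy v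
      = ∫⁻ ξ, liminf (fun k : ℕ => ENNReal.ofReal ((k : ℝ) + 1) *
          (ENNReal.ofReal (1 - Real.exp (-(1 / ((k : ℝ) + 1)) * (2 * Real.pi * ‖ξ‖) ^ 2)) *
            ‖fourier v ξ‖ₑ ^ 2)) atTop := by
        refine lintegral_congr fun ξ => (Tendsto.liminf_eq ?_).symm
        simp_rw [← mul_assoc, ← ENNReal.ofReal_mul (show ∀ {k : ℕ}, (0 : ℝ) ≤ (k : ℝ) + 1 by
          intro k; positivity)]
        refine ENNReal.Tendsto.mul_const ?_ (Or.inr (by simp))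
        exact ENNReal.tendsto_ofReal (tendsto_mul_one_sub_exp _)
    _ ≤ liminf (fun k : ℕ => ∫⁻ ξ, ENNReal.ofReal ((k : ℝ) + 1) *
          (ENNReal.ofReal (1 - Real.exp (-(1 / ((k : ℝ) + 1)) * (2 * Real.pi * ‖ξ‖) ^ 2)) *
            ‖fourier v ξ‖ₑ ^ 2)) atTop := lintegral_liminf_le fun k => by fun_prop
    _ ≤ liminf (fun _ : ℕ => gradEnergy u) atTop := by
        refine liminf_le_liminf (Eventually.of_forall fun k => ?_)
        rw [lintegral_const_mul _ (by fun_prop)]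
        have hk : (0 : ℝ) < (k : ℝ) + 1 := by positivity
        refine (mul_le_mul_right (h (1 / ((k : ℝ) + 1)) (by positivity)) _).trans ?_
        have hu := measurable_fourier u
        unfold heatSpec
        rw [← lintegral_const_mul _ (by fun_prop)]
        refine lintegral_mono fun ξ => ?_
        simp only
        rw [← mul_assoc, ← ENNReal.ofReal_mul hk.le]
        gcongr
        have := one_sub_exp_le (1 / ((k : ℝ) + 1) * (2 * Real.pi * ‖ξ‖) ^ 2)
        rw [← neg_mul] at this
        calc _ ≤ ((k : ℝ) + 1) * (1 / ((k : ℝ) + 1) * (2 * Real.pi * ‖ξ‖) ^ 2) := by gcongr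
          _ = _ := by field_simp
    _ = gradEnergy u := by simp

lemma integrableOn_subordinator {s : ℝ} (hs : s ∈ Set.Ioo (0 : ℝ) 1) :
    IntegrableOn (fun t : ℝ => t ^ (-1 - s) * (1 - Real.exp (-t))) (Set.Ioi 0) := by
  have hm : ∀ S : Set ℝ, AEStronglyMeasurable (fun t : ℝ => t ^ (-1 - s) * (1 - Real.exp (-t)))
      (volume.restrict S) := fun S => by
    refine Measurable.aestronglyMeasurable ?_
    fun_prop
  rw [← Set.Ioc_union_Ioi_eq_Ioi zero_le_one]
  refine IntegrableOn.union ?_ ?_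
  · have h1 : IntegrableOn (fun t : ℝ => t ^ (-s)) (Set.Ioc 0 1) := by
      rw [← intervalIntegrable_iff_integrableOn_Ioc_of_le zero_le_one]
      exact intervalIntegral.intervalIntegrable_rpow' (by linarith [hs.2])
    refine h1.mono' (hm _) ((ae_restrict_mem measurableSet_Ioc).mono fun t ht => ?_)
    have ht0 : 0 < t := ht.1
    have e1 : 0 ≤ 1 - Real.exp (-t) := by
      have : Real.exp (-t) ≤ 1 := Real.exp_le_one_iff.2 (by linarith)
      linarith
    rw [Real.norm_of_nonneg (by positivity)]
    calc t ^ (-1 - s) * (1 - Real.exp (-t)) ≤ t ^ (-1 - s) * t := by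
          gcongr; exact one_sub_exp_le t
      _ = t ^ (-s) := by
          rw [← Real.rpow_add_one ht0.ne']; congr 1; ring
  · have h1 : IntegrableOn (fun t : ℝ => t ^ (-1 - s)) (Set.Ioi 1) :=
      integrableOn_Ioi_rpow_of_lt (by linarith [hs.1]) zero_lt_one
    refine h1.mono' (hm _) ((ae_restrict_mem measurableSet_Ioi).mono fun t ht => ?_)
    have ht0 : (0 : ℝ) < t := zero_lt_one.trans ht
    have e1 : 0 ≤ 1 - Real.exp (-t) := by
      have : Real.exp (-t) ≤ 1 := Real.exp_le_one_iff.2 (by linarith)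
      linarith
    rw [Real.norm_of_nonneg (by positivity)]
    exact mul_le_of_le_one_right (by positivity) (by linarith [Real.exp_nonneg (-t)])

/-- The normalizing constant of the subordination formula for fractional powers. -/
def subordConst (s : ℝ) : ℝ := ∫ t in Set.Ioi (0 : ℝ), t ^ (-1 - s) * (1 - Real.exp (-t))

lemma subordConst_pos {s : ℝ} (hs : s ∈ Set.Ioo (0 : ℝ) 1) : 0 < subordConst s := by
  unfold subordConst
  rw [setIntegral_pos_iff_support_of_nonneg_ae _ (integrableOn_subordinator hs)]
  · refine lt_of_lt_of_le ?_ (measure_mono (s := Set.Ioi (0 : ℝ)) fun t ht => ⟨?_, ht⟩)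
    · simp
    · have ht0 : (0 : ℝ) < t := ht
      have : Real.exp (-t) < 1 := by rw [Real.exp_lt_one_iff]; linarith
      have h2 : 0 < t ^ (-1 - s) * (1 - Real.exp (-t)) := mul_pos (by positivity) (by linarith)
      exact h2.ne'
  · refine (ae_restrict_mem measurableSet_Ioi).mono fun t ht => ?_
    have ht0 : (0 : ℝ) < t := ht
    have : Real.exp (-t) ≤ 1 := Real.exp_le_one_iff.2 (by linarith)
    exact mul_nonneg (by positivity) (by linarith)

/-- Subordination: `∫₀^∞ t^{-1-s} (1 - exp (-t x)) dt = c_s x^s`. -/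
lemma lintegral_subordinator {s : ℝ} (hs : s ∈ Set.Ioo (0 : ℝ) 1) {x : ℝ} (hx : 0 ≤ x) :
    ∫⁻ t in Set.Ioi (0 : ℝ), ENNReal.ofReal (t ^ (-1 - s)) * ENNReal.ofReal (1 - Real.exp (-t * x)) =
      ENNReal.ofReal (subordConst s) * ENNReal.ofReal (x ^ s) := by
  rcases hx.eq_or_lt with rfl | hx
  · simp [Real.zero_rpow hs.1.ne']
  set f : ℝ → ℝ := fun t => t ^ (-1 - s) * (1 - Real.exp (-t)) with hf
  have key : ∀ t ∈ Set.Ioi (0 : ℝ), ENNReal.ofReal (t ^ (-1 - s)) *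
      ENNReal.ofReal (1 - Real.exp (-t * x)) = ENNReal.ofReal (x ^ (1 + s) * f (x * t)) := by
    intro t ht
    have ht0 : (0 : ℝ) < t := ht
    rw [← ENNReal.ofReal_mul (by positivity)]
    congr 1
    rw [hf]
    simp only
    rw [Real.mul_rpow hx.le ht0.le, ← mul_assoc, ← mul_assoc, ← Real.rpow_add hx]
    have : (1 + s + (-1 - s)) = 0 := by ring
    rw [this, Real.rpow_zero, one_mul, neg_mul, mul_comm t x]
  rw [setLIntegral_congr_fun measurableSet_Ioi key, ← ofReal_integral_eq_lintegral_ofReal]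
  · rw [integral_const_mul, integral_comp_mul_left_Ioi f 0 hx, mul_zero, smul_eq_mul,
      ← ENNReal.ofReal_mul (subordConst_pos hs).le]
    congr 1
    rw [Real.rpow_add hx, Real.rpow_one, hf, ← subordConst]
    field_simp
  · have := (integrableOn_Ioi_comp_mul_left_iff f 0 hx).2 (by simpa using integrableOn_subordinator hs)
    exact this.const_mul _
  · refine (ae_restrict_mem measurableSet_Ioi).mono fun t ht => ?_
    have ht0 : (0 : ℝ) < t := ht
    have : Real.exp (-(x * t)) ≤ 1 := Real.exp_le_one_iff.2 (by nlinarith)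
    simp only [Pi.zero_apply, hf]
    exact mul_nonneg (by positivity) (mul_nonneg (by positivity) (by linarith))

lemma fracEnergy_eq {s : ℝ} (hs : s ∈ Set.Ioo (0 : ℝ) 1) (u : L2 n) :
    ENNReal.ofReal (subordConst s) * fracEnergy s u =
      ∫⁻ t in Set.Ioi (0 : ℝ), ENNReal.ofReal (t ^ (-1 - s)) * heatSpec t u := by
  have hu := measurable_fourier u
  unfold fracEnergy heatSpec
  rw [← lintegral_const_mul _ (by fun_prop)]
  calc ∫⁻ ξ, ENNReal.ofReal (subordConst s) *
        (ENNReal.ofReal ((2 * Real.pi * ‖ξ‖) ^ (2 * s)) * ‖fourier u ξ‖ₑ ^ 2)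
      = ∫⁻ ξ, ∫⁻ t in Set.Ioi (0 : ℝ), ENNReal.ofReal (t ^ (-1 - s)) *
          ENNReal.ofReal (1 - Real.exp (-t * (2 * Real.pi * ‖ξ‖) ^ 2)) * ‖fourier u ξ‖ₑ ^ 2 := by
        refine lintegral_congr fun ξ => ?_
        rw [lintegral_mul_const _ (by fun_prop), lintegral_subordinator hs (by positivity),
          ← Real.rpow_natCast, ← Real.rpow_mul (by positivity), Nat.cast_ofNat]
        ring
    _ = ∫⁻ t in Set.Ioi (0 : ℝ), ∫⁻ ξ, ENNReal.ofReal (t ^ (-1 - s)) *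
          ENNReal.ofReal (1 - Real.exp (-t * (2 * Real.pi * ‖ξ‖) ^ 2)) * ‖fourier u ξ‖ₑ ^ 2 := by
        refine lintegral_lintegral_swap (Measurable.aemeasurable ?_)
        fun_prop
    _ = _ := by
        refine lintegral_congr fun t => ?_
        simp_rw [mul_assoc]
        rw [lintegral_const_mul _ (by fun_prop)]

lemma measurable_heatSpec (u : L2 n) : Measurable fun t => heatSpec t u := by
  have hu := measurable_fourier u
  unfold heatSpec
  refine Measurable.lintegral_prod_right' (f := fun q : ℝ × Eucl n =>
    ENNReal.ofReal (1 - Real.exp (-q.1 * (2 * Real.pi * ‖q.2‖) ^ 2)) * ‖fourier u q.2‖ₑ ^ 2) ?_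
  fun_prop

lemma ofReal_subordConst_ne_zero {s : ℝ} (hs : s ∈ Set.Ioo (0 : ℝ) 1) :
    ENNReal.ofReal (subordConst s) ≠ 0 := by
  rw [Ne, ENNReal.ofReal_eq_zero, not_le]
  exact subordConst_pos hs

lemma fracEnergy_mono {s : ℝ} (hs : s ∈ Set.Ioo (0 : ℝ) 1) {u v : L2 n}
    (h : ∀ t > 0, heatSpec t v ≤ heatSpec t u) : fracEnergy s v ≤ fracEnergy s u := by
  rw [← ENNReal.mul_le_mul_iff_right (ofReal_subordConst_ne_zero hs) ENNReal.ofReal_ne_top,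
    fracEnergy_eq hs, fracEnergy_eq hs]
  refine setLIntegral_mono' measurableSet_Ioi fun t ht => ?_
  gcongr
  exact h t ht

lemma exists_heatSpec_eq {s : ℝ} (hs : s ∈ Set.Ioo (0 : ℝ) 1) {u v : L2 n}
    (h : ∀ t > 0, heatSpec t v ≤ heatSpec t u) (hu : fracEnergy s u ≠ ∞)
    (heq : fracEnergy s v = fracEnergy s u) : ∃ t > 0, heatSpec t v = heatSpec t u := by
  have h1 := fracEnergy_eq hs v
  rw [heq, fracEnergy_eq hs u] at h1
  have hfin : ∫⁻ t in Set.Ioi (0 : ℝ), ENNReal.ofReal (t ^ (-1 - s)) * heatSpec t v ≠ ∞ := by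
    rw [← fracEnergy_eq hs, heq]
    exact ENNReal.mul_ne_top ENNReal.ofReal_ne_top hu
  have hmu := measurable_heatSpec u
  have hae := ae_eq_of_ae_le_of_lintegral_le (μ := volume.restrict (Set.Ioi (0 : ℝ)))
    (f := fun t => ENNReal.ofReal (t ^ (-1 - s)) * heatSpec t v)
    (g := fun t => ENNReal.ofReal (t ^ (-1 - s)) * heatSpec t u)
    ((ae_restrict_mem measurableSet_Ioi).mono fun t ht => mul_le_mul_right (h t ht) _) hfin
    (by fun_prop) h1.le
  have hne : (ae (volume.restrict (Set.Ioi (0 : ℝ)))).NeBot := by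
    rw [ae_neBot]; simp [Measure.restrict_eq_zero]
  obtain ⟨t, ht, ht0⟩ := (hae.and (ae_restrict_mem measurableSet_Ioi)).exists
  have ht0' : (0 : ℝ) < t := ht0
  refine ⟨t, ht0, ?_⟩
  refine (ENNReal.mul_right_inj ?_ ENNReal.ofReal_ne_top).1 ht
  rw [Ne, ENNReal.ofReal_eq_zero, not_le]
  positivity

/-- The squared energy norm `‖u‖_s²` as an extended nonnegative number. -/
def energy (s : ℝ) (u : L2 n) : ℝ≥0∞ :=
  ∫⁻ ξ, ENNReal.ofReal (symbol s ξ) * ‖fourier u ξ‖ₑ ^ 2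

lemma measurable_symbol (s : ℝ) : Measurable (symbol s : Eucl n → ℝ) := by
  unfold symbol; fun_prop

lemma one_add_sq_le_symbol (s : ℝ) (ξ : Eucl n) : 1 + (2 * Real.pi * ‖ξ‖) ^ 2 ≤ symbol s ξ := by
  unfold symbol
  have : 0 ≤ (2 * Real.pi * ‖ξ‖) ^ (2 * s) := by positivity
  linarith

lemma symbol_pos (s : ℝ) (ξ : Eucl n) : 0 < symbol s ξ :=
  lt_of_lt_of_le (by positivity) (one_add_sq_le_symbol s ξ)

lemma symbol_le {s : ℝ} (hs : s ∈ Set.Ioo (0 : ℝ) 1) (ξ : Eucl n) :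
    symbol s ξ ≤ 2 * (1 + (2 * Real.pi * ‖ξ‖) ^ 2) := by
  unfold symbol
  set r := 2 * Real.pi * ‖ξ‖ with hr
  have hr0 : 0 ≤ r := by positivity
  suffices r ^ (2 * s) ≤ 1 + r ^ 2 by linarith
  rcases le_total r 1 with h | h
  · have := Real.rpow_le_one hr0 h (show 0 ≤ 2 * s by linarith [hs.1])
    nlinarith
  · have := Real.rpow_le_rpow_of_exponent_le h (show 2 * s ≤ 2 by linarith [hs.2])
    rw [Real.rpow_two] at this
    linarith

lemma enorm_sq_eq_ofReal (z : ℂ) : ‖z‖ₑ ^ 2 = ENNReal.ofReal (‖z‖ ^ 2) := by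
  rw [ENNReal.ofReal_pow (norm_nonneg _), ofReal_norm]

lemma energy_eq (s : ℝ) (u : L2 n) :
    energy s u = ‖u‖ₑ ^ 2 + gradEnergy u + fracEnergy s u := by
  have hu := measurable_fourier u
  have h0 : ‖u‖ₑ ^ 2 = ∫⁻ ξ, ‖fourier u ξ‖ₑ ^ 2 := by
    rw [lintegral_enorm_sq_eq, ← ofReal_norm, ← ofReal_norm, norm_fourier]
  unfold energy gradEnergy fracEnergy
  rw [h0, ← lintegral_add_left (by fun_prop), ← lintegral_add_left (by fun_prop)]
  refine lintegral_congr fun ξ => ?_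
  unfold symbol
  rw [ENNReal.ofReal_add (by positivity) (by positivity),
    ENNReal.ofReal_add (by positivity) (by positivity), ENNReal.ofReal_one]
  ring

lemma memH1_iff {s : ℝ} (hs : s ∈ Set.Ioo (0 : ℝ) 1) (u : L2 n) :
    MemH1 u ↔ energy s u ≠ ∞ := by
  have hu := measurable_fourier u
  have hsm := measurable_symbol (n := n) s
  have key : energy s u ≠ ∞ ↔ Integrable (fun ξ => symbol s ξ * ‖fourier u ξ‖ ^ 2) := by
    rw [← lintegral_ofReal_ne_top_iff_integrable]
    · unfold energy
      refine not_congr (Eq.congr_left (lintegral_congr fun ξ => ?_))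
      rw [ENNReal.ofReal_mul (symbol_pos s ξ).le, enorm_sq_eq_ofReal]
    · exact Measurable.aestronglyMeasurable (by fun_prop)
    · exact ae_of_all _ fun ξ => mul_nonneg (symbol_pos s ξ).le (by positivity)
  rw [key]
  constructor
  · intro h
    refine (h.const_mul 2).mono' (Measurable.aestronglyMeasurable (by fun_prop))
      (ae_of_all _ fun ξ => ?_)
    rw [Real.norm_of_nonneg (mul_nonneg (symbol_pos s ξ).le (by positivity)), ← mul_assoc]
    gcongr
    exact symbol_le hs ξ
  · intro h
    refine h.mono' (Measurable.aestronglyMeasurable (by fun_prop)) (ae_of_all _ fun ξ => ?_)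
    rw [Real.norm_of_nonneg (by positivity)]
    gcongr
    exact one_add_sq_le_symbol s ξ

lemma innerS_self (s : ℝ) (u : L2 n) : innerS s u u = (energy s u).toReal := by
  have hu := measurable_fourier u
  have hsm := measurable_symbol (n := n) s
  unfold innerS energy
  have h : ∀ ξ, symbol s ξ * (fourier u ξ * (starRingEnd ℂ) (fourier u ξ)).re =
      symbol s ξ * ‖fourier u ξ‖ ^ 2 := fun ξ => by
    rw [Complex.mul_conj, Complex.ofReal_re, Complex.normSq_eq_norm_sq]
  simp_rw [h]
  rw [integral_eq_lintegral_of_nonneg_ae]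
  · congr 1
    refine lintegral_congr fun ξ => ?_
    rw [ENNReal.ofReal_mul (symbol_pos s ξ).le, enorm_sq_eq_ofReal]
  · exact ae_of_all _ fun ξ => mul_nonneg (symbol_pos s ξ).le (by positivity)
  · exact Measurable.aestronglyMeasurable (by fun_prop)

lemma innerS_self_nonneg (s : ℝ) (u : L2 n) : 0 ≤ innerS s u u := by
  rw [innerS_self]; exact ENNReal.toReal_nonneg

lemma heatSpec_le_of_heatEnergy_le {u v : L2 n}
    (h : ∀ b > 0, heatEnergy b v ≤ heatEnergy b u) (t : ℝ) (ht : 0 < t) :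
    heatSpec t v ≤ heatSpec t u := by
  have := (heatSpec_le_iff (b := 1 / (4 * t)) (by positivity) u v).1 (h _ (by positivity))
  have e : 1 / (4 * (1 / (4 * t))) = t := by field_simp
  rwa [e] at this

lemma energy_mono {s : ℝ} (hs : s ∈ Set.Ioo (0 : ℝ) 1) {u v : L2 n} (hn : ‖v‖ = ‖u‖)
    (h : ∀ b > 0, heatEnergy b v ≤ heatEnergy b u) : energy s v ≤ energy s u := by
  have h' := heatSpec_le_of_heatEnergy_le h
  rw [energy_eq, energy_eq, ← ofReal_norm, ← ofReal_norm, hn]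
  gcongr
  · exact gradEnergy_mono h'
  · exact fracEnergy_mono hs h'

/-- If the heat energies of `v` are at most those of `u` and the total energies agree, then one of
the heat energies agrees. -/
lemma exists_heatEnergy_eq {s : ℝ} (hs : s ∈ Set.Ioo (0 : ℝ) 1) {u v : L2 n} (hu : MemH1 u)
    (hn : ‖v‖ = ‖u‖) (h : ∀ b > 0, heatEnergy b v ≤ heatEnergy b u)
    (heq : energy s v = energy s u) : ∃ b > 0, heatEnergy b v = heatEnergy b u := by
  have h' := heatSpec_le_of_heatEnergy_le h
  have hfin := (memH1_iff hs u).1 hu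
  have hg := gradEnergy_mono h'
  have hf := fracEnergy_mono hs h'
  have hfin2 := hfin
  rw [energy_eq] at hfin
  have hfr : fracEnergy s u ≠ ∞ := fun h0 => hfin (by rw [h0, add_top])
  have hfeq : fracEnergy s v = fracEnergy s u := by
    refine le_antisymm hf ?_
    rw [energy_eq, energy_eq, ← ofReal_norm, ← ofReal_norm, hn, ofReal_norm] at heq
    by_contra hlt
    rw [not_le] at hlt
    have : ‖u‖ₑ ^ 2 + gradEnergy v + fracEnergy s v < ‖u‖ₑ ^ 2 + gradEnergy u + fracEnergy s u := by
      refine ENNReal.add_lt_add_of_le_of_lt ?_ (by gcongr) hlt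
      intro h0
      refine hfin ?_
      rw [show ‖u‖ₑ ^ 2 + gradEnergy u = ∞ from top_le_iff.1 (h0 ▸ by gcongr), top_add]
    exact this.ne heq
  obtain ⟨t, ht, hte⟩ := exists_heatSpec_eq hs h' hfr hfeq
  refine ⟨1 / (4 * t), by positivity, ?_⟩
  have e : 1 / (4 * (1 / (4 * t))) = t := by field_simp
  rw [heatEnergy_eq (by positivity), heatEnergy_eq (by positivity), e, hte]

/-- Reflection in the hyperplane `{x | ⟨e, x⟩ = c}`, for a unit vector `e`. -/
def hreflect (e : Eucl n) (c : ℝ) (x : Eucl n) : Eucl n := x - (2 * (inner ℝ e x - c)) • e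

/-- The open half-space `{x | c < ⟨e, x⟩}`. -/
def halfSpace (e : Eucl n) (c : ℝ) : Set (Eucl n) := {x | c < inner ℝ e x}

lemma measurableSet_halfSpace (e : Eucl n) (c : ℝ) : MeasurableSet (halfSpace e c) :=
  measurableSet_lt measurable_const (by fun_prop)

@[fun_prop]
lemma measurable_hreflect (e : Eucl n) (c : ℝ) : Measurable (hreflect e c) := by
  unfold hreflect; fun_prop

lemma inner_hreflect {e : Eucl n} (he : ‖e‖ = 1) (c : ℝ) (x : Eucl n) :
    inner ℝ e (hreflect e c x) = 2 * c - inner ℝ e x := by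
  unfold hreflect
  rw [inner_sub_right, inner_smul_right, real_inner_self_eq_norm_sq, he]
  ring

lemma hreflect_hreflect {e : Eucl n} (he : ‖e‖ = 1) (c : ℝ) (x : Eucl n) :
    hreflect e c (hreflect e c x) = x := by
  rw [hreflect, inner_hreflect he, hreflect]
  module

lemma norm_sub_hreflect_sq {e : Eucl n} (he : ‖e‖ = 1) (c : ℝ) (x y : Eucl n) :
    ‖x - hreflect e c y‖ ^ 2 =
      ‖x - y‖ ^ 2 + 4 * ((inner ℝ e x - c) * (inner ℝ e y - c)) := by
  unfold hreflect
  rw [show x - (y - (2 * (inner ℝ e y - c)) • e) = (x - y) + (2 * (inner ℝ e y - c)) • e by abel,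
    norm_add_sq_real, inner_smul_right, norm_smul, he, mul_one, Real.norm_eq_abs, sq_abs,
    inner_sub_left, real_inner_comm e x, real_inner_comm e y]
  ring

lemma norm_hreflect_sub {e : Eucl n} (he : ‖e‖ = 1) (c : ℝ) (x y : Eucl n) :
    ‖hreflect e c x - hreflect e c y‖ = ‖x - y‖ := by
  have h : ‖hreflect e c x - hreflect e c y‖ ^ 2 = ‖x - y‖ ^ 2 := by
    rw [norm_sub_hreflect_sq he, inner_hreflect he, norm_sub_rev, norm_sub_hreflect_sq he,
      norm_sub_rev]
    ring
  exact (sq_eq_sq₀ (norm_nonneg _) (norm_nonneg _)).1 h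

lemma measurePreserving_hreflect {e : Eucl n} (he : ‖e‖ = 1) (c : ℝ) :
    MeasurePreserving (hreflect e c) (volume : Measure (Eucl n)) volume := by
  have h1 := (Submodule.reflection (ℝ ∙ e)ᗮ).measurePreserving
  have h2 := (measurePreserving_add_right (volume : Measure (Eucl n)) ((2 * c) • e)).comp h1
  suffices h : hreflect e c = (fun x => x + (2 * c) • e) ∘ (Submodule.reflection (ℝ ∙ e)ᗮ) by
    rw [h]; exact h2
  funext x
  simp only [Function.comp_apply, hreflect]
  rw [Submodule.reflection_orthogonal_apply, Submodule.reflection_apply,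
    Submodule.starProjection_unit_singleton ℝ he]
  module

lemma measurableEmbedding_hreflect {e : Eucl n} (he : ‖e‖ = 1) (c : ℝ) :
    MeasurableEmbedding (hreflect e c) :=
  MeasurableEmbedding.of_measurable_inverse (measurable_hreflect e c)
    (by rw [Set.range_eq_univ.2 (Function.Involutive.surjective (hreflect_hreflect he c))]
        exact MeasurableSet.univ)
    (measurable_hreflect e c) (hreflect_hreflect he c)

lemma volume_hyperplane {e : Eucl n} (he : ‖e‖ = 1) (c : ℝ) :
    volume {x : Eucl n | inner ℝ e x = c} = 0 := by
  have h := Measure.addHaar_affineSubspace (volume : Measure (Eucl n))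
    (AffineSubspace.mk' (c • e) (LinearMap.ker (innerₗ (Eucl n) e))) ?_
  · convert h using 2
    ext x
    simp [AffineSubspace.mem_mk', inner_sub_right, inner_smul_right, he, sub_eq_zero]
  · intro htop
    have : (c + 1) • e ∈ AffineSubspace.mk' (c • e) (LinearMap.ker (innerₗ (Eucl n) e)) := by
      rw [htop]; trivial
    simp [AffineSubspace.mem_mk', inner_sub_right, inner_smul_right, he] at this

lemma ae_inner_ne {e : Eucl n} (he : ‖e‖ = 1) (c : ℝ) : ∀ᵐ x : Eucl n, inner ℝ e x ≠ c := by
  rw [ae_iff]; simpa using volume_hyperplane he c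

/-- Folding an integral over the whole space to a half-space. -/
lemma lintegral_eq_halfSpace {e : Eucl n} (he : ‖e‖ = 1) (c : ℝ) {f : Eucl n → ℝ≥0∞}
    (hf : Measurable f) :
    ∫⁻ x, f x = ∫⁻ x in halfSpace e c, (f x + f (hreflect e c x)) := by
  rw [lintegral_add_left hf, ← lintegral_add_compl f (measurableSet_halfSpace e c)]
  congr 1
  have h1 : (halfSpace e c)ᶜ =ᵐ[volume] hreflect e c ⁻¹' (halfSpace e c) := by
    filter_upwards [ae_inner_ne he c] with x hx
    refine propext ?_
    change (¬ c < inner ℝ e x) ↔ c < inner ℝ e (hreflect e c x)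
    rw [inner_hreflect he, not_lt]
    constructor
    · intro h; have := lt_of_le_of_ne h hx; linarith
    · intro h; linarith
  have h2 := (measurePreserving_hreflect he c).setLIntegral_comp_preimage
    (measurableSet_halfSpace e c) (hf.comp (measurable_hreflect e c))
  simp_rw [Function.comp_apply, hreflect_hreflect he] at h2
  rw [← h2]
  exact setLIntegral_congr h1

/-- Two-point rearrangement of `u` with respect to a half-space. -/
def polarize (e : Eucl n) (c : ℝ) (u : Eucl n → ℝ) (x : Eucl n) : ℝ :=
  open Classical in
  if x ∈ halfSpace e c then max (u x) (u (hreflect e c x)) else min (u x) (u (hreflect e c x))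

lemma measurable_polarize (e : Eucl n) (c : ℝ) {u : Eucl n → ℝ} (hu : Measurable u) :
    Measurable (polarize e c u) := by
  unfold polarize
  exact Measurable.ite (measurableSet_halfSpace e c) (by fun_prop) (by fun_prop)

lemma polarize_of_mem {e : Eucl n} {c : ℝ} (u : Eucl n → ℝ) {x : Eucl n} (hx : x ∈ halfSpace e c) :
    polarize e c u x = max (u x) (u (hreflect e c x)) := if_pos hx

lemma polarize_hreflect {e : Eucl n} (he : ‖e‖ = 1) {c : ℝ} (u : Eucl n → ℝ) {x : Eucl n}
    (hx : x ∈ halfSpace e c) :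
    polarize e c u (hreflect e c x) = min (u x) (u (hreflect e c x)) := by
  have : hreflect e c x ∉ halfSpace e c := by
    have hx' : c < inner ℝ e x := hx
    change ¬ c < inner ℝ e (hreflect e c x)
    rw [inner_hreflect he]; linarith
  unfold polarize
  rw [if_neg this, hreflect_hreflect he, min_comm]

lemma lintegral_comp_polarize {e : Eucl n} (he : ‖e‖ = 1) (c : ℝ) {u : Eucl n → ℝ}
    (hu : Measurable u) {f : ℝ → ℝ≥0∞} (hf : Measurable f) :
    ∫⁻ x, f (polarize e c u x) = ∫⁻ x, f (u x) := by
  have hp := measurable_polarize e c hu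
  rw [lintegral_eq_halfSpace he c (f := fun x => f (u x)) (by fun_prop),
    lintegral_eq_halfSpace he c (f := fun x => f (polarize e c u x)) (by fun_prop)]
  refine setLIntegral_congr_fun (measurableSet_halfSpace e c) fun x hx => ?_
  rw [polarize_of_mem u hx, polarize_hreflect he u hx]
  rcases le_total (u x) (u (hreflect e c x)) with h | h
  · rw [max_eq_right h, min_eq_left h, add_comm]
  · rw [max_eq_left h, min_eq_right h]

/-- The interaction of two pairs of values under the kernel values `k ≥ l`. -/
def pairEnergy (k l a a' b b' : ℝ) : ℝ :=
  k * ((a - b) ^ 2 + (a' - b') ^ 2) + l * ((a - b') ^ 2 + (a' - b) ^ 2)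

lemma pairEnergy_sub (k l a a' b b' : ℝ) :
    pairEnergy k l a a' b b' - pairEnergy k l (max a a') (min a a') (max b b') (min b b') =
      (k - l) * (|a - a'| * |b - b'| - (a - a') * (b - b')) := by
  unfold pairEnergy
  rcases le_total a a' with h | h <;> rcases le_total b b' with h' | h' <;>
    simp only [max_eq_left, max_eq_right, min_eq_left, min_eq_right, h, h', abs_of_nonneg,
      abs_of_nonpos, sub_nonneg, sub_nonpos] <;> ring

lemma heatEnergy_eq_pairEnergy {e : Eucl n} (he : ‖e‖ = 1) (c b : ℝ) {u : Eucl n → ℝ}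
    (hu : Measurable u) :
    heatEnergy b u = ∫⁻ q, ENNReal.ofReal (pairEnergy (Real.exp (-b * ‖q.1 - q.2‖ ^ 2))
      (Real.exp (-b * ‖q.1 - hreflect e c q.2‖ ^ 2)) (u q.1) (u (hreflect e c q.1))
      (u q.2) (u (hreflect e c q.2)))
      ∂((volume.restrict (halfSpace e c)).prod (volume.restrict (halfSpace e c))) := by
  rw [lintegral_prod _ (Measurable.aemeasurable (by unfold pairEnergy; fun_prop))]
  unfold heatEnergy
  rw [lintegral_eq_halfSpace he c (Measurable.lintegral_prod_right' (f := fun q : Eucl n × Eucl n =>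
    ENNReal.ofReal (Real.exp (-b * ‖q.1 - q.2‖ ^ 2)) * ‖u q.1 - u q.2‖ₑ ^ 2) (by fun_prop))]
  refine lintegral_congr fun x => ?_
  rw [lintegral_eq_halfSpace he c (by fun_prop),
    lintegral_eq_halfSpace he c (f := fun y => ENNReal.ofReal
      (Real.exp (-b * ‖hreflect e c x - y‖ ^ 2)) * ‖u (hreflect e c x) - u y‖ₑ ^ 2) (by fun_prop),
    ← lintegral_add_left (by fun_prop)]
  refine lintegral_congr fun y => ?_
  have h1 : ‖hreflect e c x - y‖ = ‖x - hreflect e c y‖ := by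
    rw [← norm_hreflect_sub he c, hreflect_hreflect he]
  have h2 : ∀ r : ℝ, ‖r‖ₑ ^ 2 = ENNReal.ofReal (r ^ 2) := fun r => by
    rw [← ofReal_norm, ← ENNReal.ofReal_pow (norm_nonneg _), Real.norm_eq_abs, sq_abs]
  simp only [h2, norm_hreflect_sub he, h1]
  rw [← ENNReal.ofReal_mul (by positivity), ← ENNReal.ofReal_mul (by positivity),
    ← ENNReal.ofReal_mul (by positivity), ← ENNReal.ofReal_mul (by positivity),
    ← ENNReal.ofReal_add (by positivity) (by positivity),
    ← ENNReal.ofReal_add (by positivity) (by positivity),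
    ← ENNReal.ofReal_add (by positivity) (by positivity)]
  congr 1
  unfold pairEnergy
  ring

lemma exp_reflect_lt {e : Eucl n} (he : ‖e‖ = 1) {c b : ℝ} (hb : 0 < b) {x y : Eucl n}
    (hx : x ∈ halfSpace e c) (hy : y ∈ halfSpace e c) :
    Real.exp (-b * ‖x - hreflect e c y‖ ^ 2) < Real.exp (-b * ‖x - y‖ ^ 2) := by
  rw [Real.exp_lt_exp, norm_sub_hreflect_sq he]
  have h1 : 0 < inner ℝ e x - c := sub_pos.2 hx
  have h2 : 0 < inner ℝ e y - c := sub_pos.2 hy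
  have := mul_pos hb (mul_pos h1 h2)
  nlinarith

lemma ae_mem_halfSpace_prod (e : Eucl n) (c : ℝ) :
    ∀ᵐ q ∂((volume.restrict (halfSpace e c)).prod (volume.restrict (halfSpace e c))),
      q.1 ∈ halfSpace e c ∧ q.2 ∈ halfSpace e c := by
  rw [Measure.prod_restrict]
  exact ae_restrict_mem ((measurableSet_halfSpace e c).prod (measurableSet_halfSpace e c))

lemma pairEnergy_polarize_le {e : Eucl n} (he : ‖e‖ = 1) {c b : ℝ} (hb : 0 < b)
    (u : Eucl n → ℝ) {x y : Eucl n} (hx : x ∈ halfSpace e c) (hy : y ∈ halfSpace e c) :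
    pairEnergy (Real.exp (-b * ‖x - y‖ ^ 2)) (Real.exp (-b * ‖x - hreflect e c y‖ ^ 2))
      (polarize e c u x) (polarize e c u (hreflect e c x))
      (polarize e c u y) (polarize e c u (hreflect e c y)) ≤
    pairEnergy (Real.exp (-b * ‖x - y‖ ^ 2)) (Real.exp (-b * ‖x - hreflect e c y‖ ^ 2))
      (u x) (u (hreflect e c x)) (u y) (u (hreflect e c y)) := by
  rw [polarize_of_mem u hx, polarize_of_mem u hy, polarize_hreflect he u hx,
    polarize_hreflect he u hy, ← sub_nonneg, pairEnergy_sub]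
  have h1 := sub_pos.2 (exp_reflect_lt he hb hx hy)
  have h2 : 0 ≤ |u x - u (hreflect e c x)| * |u y - u (hreflect e c y)| -
      (u x - u (hreflect e c x)) * (u y - u (hreflect e c y)) := by
    rw [← abs_mul]; linarith [le_abs_self ((u x - u (hreflect e c x)) * (u y - u (hreflect e c y)))]
  have := mul_nonneg h1.le h2
  linarith

lemma heatEnergy_polarize_le {e : Eucl n} (he : ‖e‖ = 1) (c : ℝ) {b : ℝ} (hb : 0 < b)
    {u : Eucl n → ℝ} (hu : Measurable u) :
    heatEnergy b (polarize e c u) ≤ heatEnergy b u := by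
  rw [heatEnergy_eq_pairEnergy he c b hu,
    heatEnergy_eq_pairEnergy he c b (measurable_polarize e c hu)]
  refine lintegral_mono_ae ((ae_mem_halfSpace_prod e c).mono fun q hq => ?_)
  exact ENNReal.ofReal_le_ofReal (pairEnergy_polarize_le he hb u hq.1 hq.2)

/-- Strictness of the two-point rearrangement inequality: in the equality case `u` and its
reflection are ordered on the half-space. -/
lemma ordered_of_heatEnergy_polarize_eq {e : Eucl n} (he : ‖e‖ = 1) {c b : ℝ} (hb : 0 < b)
    {u : Eucl n → ℝ} (hu : Measurable u) (hfin : heatEnergy b u ≠ ∞)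
    (heq : heatEnergy b (polarize e c u) = heatEnergy b u) :
    (∀ᵐ x ∂(volume.restrict (halfSpace e c)), u (hreflect e c x) ≤ u x) ∨
    (∀ᵐ x ∂(volume.restrict (halfSpace e c)), u x ≤ u (hreflect e c x)) := by
  have hp := measurable_polarize e c hu
  have hfin' := hfin
  rw [← heq, heatEnergy_eq_pairEnergy he c b hp] at hfin'
  rw [heatEnergy_eq_pairEnergy he c b hu, heatEnergy_eq_pairEnergy he c b hp] at heq
  have hae := ae_eq_of_ae_le_of_lintegral_le ((ae_mem_halfSpace_prod e c).mono fun q hq =>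
    ENNReal.ofReal_le_ofReal (pairEnergy_polarize_le he hb u hq.1 hq.2)) hfin'
    (Measurable.aemeasurable (by unfold pairEnergy; fun_prop)) heq.ge
  have hprod : ∀ᵐ q ∂((volume.restrict (halfSpace e c)).prod (volume.restrict (halfSpace e c))),
      0 ≤ (u q.1 - u (hreflect e c q.1)) * (u q.2 - u (hreflect e c q.2)) := by
    filter_upwards [hae, ae_mem_halfSpace_prod e c] with q hq hmem
    have hnn : ∀ k l a a' b b' : ℝ, 0 ≤ k → 0 ≤ l → 0 ≤ pairEnergy k l a a' b b' := by
      intro k l a a' b b' hk hl; unfold pairEnergy; positivity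
    rw [ENNReal.ofReal_eq_ofReal_iff (hnn _ _ _ _ _ _ (Real.exp_nonneg _) (Real.exp_nonneg _))
      (hnn _ _ _ _ _ _ (Real.exp_nonneg _) (Real.exp_nonneg _)), polarize_of_mem u hmem.1,
      polarize_of_mem u hmem.2, polarize_hreflect he u hmem.1,
      polarize_hreflect he u hmem.2] at hq
    have h0 := pairEnergy_sub (Real.exp (-b * ‖q.1 - q.2‖ ^ 2))
      (Real.exp (-b * ‖q.1 - hreflect e c q.2‖ ^ 2)) (u q.1) (u (hreflect e c q.1))
      (u q.2) (u (hreflect e c q.2))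
    rw [hq, sub_self] at h0
    have h1 := sub_pos.2 (exp_reflect_lt he hb hmem.1 hmem.2)
    have h2 : (Real.exp (-b * ‖q.1 - q.2‖ ^ 2) - Real.exp (-b * ‖q.1 - hreflect e c q.2‖ ^ 2)) *
      (|u q.1 - u (hreflect e c q.1)| * |u q.2 - u (hreflect e c q.2)| -
        (u q.1 - u (hreflect e c q.1)) * (u q.2 - u (hreflect e c q.2))) = 0 := by linarith
    have h3 := (mul_eq_zero.1 h2).resolve_left h1.ne'
    have := mul_nonneg (abs_nonneg (u q.1 - u (hreflect e c q.1)))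
      (abs_nonneg (u q.2 - u (hreflect e c q.2)))
    linarith
  have hae2 := Measure.ae_ae_of_ae_prod hprod
  by_cases hcase : ∀ᵐ x ∂(volume.restrict (halfSpace e c)), u x ≤ u (hreflect e c x)
  · exact Or.inr hcase
  · left
    rw [not_eventually] at hcase
    simp only [not_le] at hcase
    obtain ⟨x, hx, hxy⟩ := (hcase.and_eventually hae2).exists
    filter_upwards [hxy] with y hy
    have := nonneg_of_mul_nonneg_right hy (sub_pos.2 hx)
    linarith

lemma MemH1.add {u v : L2 n} (hu : MemH1 u) (hv : MemH1 v) : MemH1 (u + v) := by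
  have hm := measurable_fourier (u + v)
  refine ((Integrable.add hu hv).const_mul 2).mono'
    (Measurable.aestronglyMeasurable (by fun_prop)) ?_
  rw [fourier_add] at *
  filter_upwards [Lp.coeFn_add (fourier u) (fourier v)] with ξ hξ
  rw [Real.norm_of_nonneg (by positivity), hξ]
  simp only [Pi.add_apply]
  have h1 : ‖fourier u ξ + fourier v ξ‖ ^ 2 ≤ 2 * (‖fourier u ξ‖ ^ 2 + ‖fourier v ξ‖ ^ 2) := by
    have := norm_add_le (fourier u ξ) (fourier v ξ)
    have h0 := norm_nonneg (fourier u ξ + fourier v ξ)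
    nlinarith [sq_nonneg (‖fourier u ξ‖ - ‖fourier v ξ‖)]
  calc _ ≤ (1 + (2 * Real.pi * ‖ξ‖) ^ 2) * (2 * (‖fourier u ξ‖ ^ 2 + ‖fourier v ξ‖ ^ 2)) := by
        gcongr
    _ = _ := by ring

lemma coeFn_fourier_smul (c : ℝ) (u : L2 n) :
    fourier (c • u) =ᵐ[volume] fun ξ => (c : ℂ) * fourier u ξ := by
  rw [fourier_smul]
  filter_upwards [Lp.coeFn_smul (c : ℂ) (fourier u)] with ξ hξ
  rw [hξ]; rfl

lemma coeFn_fourier_add (u v : L2 n) :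
    fourier (u + v) =ᵐ[volume] fun ξ => fourier u ξ + fourier v ξ := by
  rw [fourier_add]
  exact Lp.coeFn_add _ _

lemma MemH1.smul {u : L2 n} (c : ℝ) (hu : MemH1 u) : MemH1 (c • u) := by
  refine (Integrable.const_mul hu (c ^ 2)).congr ?_
  filter_upwards [coeFn_fourier_smul c u] with ξ hξ
  rw [hξ, norm_mul, Complex.norm_real, Real.norm_eq_abs, mul_pow |c|, sq_abs]
  ring

lemma memH1_zero : MemH1 (0 : L2 n) := by
  have h : fourier (0 : L2 n) = 0 := by
    have := fourier_smul (n := n) 0 0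
    simpa using this
  unfold MemH1
  rw [h]
  refine (integrable_zero (Eucl n) ℝ volume).congr ?_
  filter_upwards [Lp.coeFn_zero ℂ 2 (volume : Measure (Eucl n))] with ξ hξ
  rw [hξ]; simp

/-- The Sobolev space `H¹(ℝⁿ)` as a subspace of `L²(ℝⁿ)`. -/
def H1 (n : ℕ) : Submodule ℝ (L2 n) where
  carrier := {u | MemH1 u}
  add_mem' hu hv := hu.add hv
  zero_mem' := memH1_zero
  smul_mem' c _ hu := hu.smul c

lemma MemH1.sub {u v : L2 n} (hu : MemH1 u) (hv : MemH1 v) : MemH1 (u - v) :=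
  (H1 n).sub_mem hu hv

lemma integrable_symbol_mul {s : ℝ} (hs : s ∈ Set.Ioo (0 : ℝ) 1) {u v : L2 n} (hu : MemH1 u)
    (hv : MemH1 v) :
    Integrable (fun ξ : Eucl n => symbol s ξ * (fourier u ξ * (starRingEnd ℂ) (fourier v ξ)).re) := by
  have hmu := measurable_fourier u
  have hmv := measurable_fourier v
  have hsm := measurable_symbol (n := n) s
  refine ((Integrable.add hu hv).const_mul 2).mono' ?_ (ae_of_all _ fun ξ => ?_)
  · refine Measurable.aestronglyMeasurable (hsm.mul (Complex.measurable_re.comp (hmu.mul ?_)))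
    exact Complex.continuous_conj.measurable.comp hmv
  · rw [norm_mul, Real.norm_of_nonneg (symbol_pos s ξ).le]
    have h1 : ‖(fourier u ξ * (starRingEnd ℂ) (fourier v ξ)).re‖ ≤
        ‖fourier u ξ‖ ^ 2 + ‖fourier v ξ‖ ^ 2 := by
      refine (Complex.abs_re_le_norm _).trans ?_
      rw [norm_mul, RCLike.norm_conj]
      nlinarith [sq_nonneg (‖fourier u ξ‖ - ‖fourier v ξ‖), sq_nonneg (‖fourier u ξ‖),
        sq_nonneg (‖fourier v ξ‖)]
    calc _ ≤ (2 * (1 + (2 * Real.pi * ‖ξ‖) ^ 2)) * (‖fourier u ξ‖ ^ 2 + ‖fourier v ξ‖ ^ 2) := by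
          gcongr
          exact symbol_le hs ξ
      _ = _ := by simp only [Pi.add_apply]; ring

lemma innerS_add_left {s : ℝ} (hs : s ∈ Set.Ioo (0 : ℝ) 1) {u v w : L2 n} (hu : MemH1 u)
    (hv : MemH1 v) (hw : MemH1 w) : innerS s (u + v) w = innerS s u w + innerS s v w := by
  unfold innerS
  rw [← integral_add (integrable_symbol_mul hs hu hw) (integrable_symbol_mul hs hv hw)]
  refine integral_congr_ae ?_
  filter_upwards [coeFn_fourier_add u v] with ξ hξ
  rw [hξ, add_mul, Complex.add_re, mul_add]

lemma innerS_smul_left {s : ℝ} (c : ℝ) (u w : L2 n) :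
    innerS s (c • u) w = c * innerS s u w := by
  unfold innerS
  rw [← integral_const_mul]
  refine integral_congr_ae ?_
  filter_upwards [coeFn_fourier_smul c u] with ξ hξ
  rw [hξ, mul_assoc, Complex.re_ofReal_mul]
  ring

lemma innerS_comm {s : ℝ} (u v : L2 n) : innerS s u v = innerS s v u := by
  unfold innerS
  congr 1
  ext ξ
  congr 1
  rw [← Complex.conj_re, map_mul, Complex.conj_conj, mul_comm]

/-- The energy scalar product as a bilinear form on `H¹(ℝⁿ)`. -/
def innerForm {s : ℝ} (hs : s ∈ Set.Ioo (0 : ℝ) 1) : LinearMap.BilinForm ℝ (H1 n) :=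
  LinearMap.mk₂ ℝ (fun u v => innerS s (u : L2 n) v)
    (fun u v w => innerS_add_left hs u.2 v.2 w.2)
    (fun c u v => innerS_smul_left c _ _)
    (fun u v w => by
      simp only [innerS_comm (u : L2 n)]
      exact innerS_add_left hs v.2 w.2 u.2)
    (fun c u v => by
      simp only [innerS_comm (u : L2 n)]
      exact innerS_smul_left c _ _)

lemma norm_sq_le_innerS {s : ℝ} (hs : s ∈ Set.Ioo (0 : ℝ) 1) {u : L2 n} (hu : MemH1 u) :
    ‖u‖ ^ 2 ≤ innerS s u u := by
  have hfin := (memH1_iff hs u).1 hu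
  rw [innerS_self]
  have h : ‖u‖ₑ ^ 2 ≤ energy s u := by
    rw [energy_eq, add_assoc]; exact le_self_add
  have := ENNReal.toReal_mono hfin h
  simpa using this

lemma innerS_self_pos {s : ℝ} (hs : s ∈ Set.Ioo (0 : ℝ) 1) {u : L2 n} (hu : MemH1 u)
    (h0 : u ≠ 0) : 0 < innerS s u u :=
  lt_of_lt_of_le (by have := norm_pos_iff.2 h0; positivity) (norm_sq_le_innerS hs hu)

/-- Completeness of `H¹(ℝⁿ)` for the energy norm. -/
lemma exists_limit_of_cauchy {s : ℝ} (hs : s ∈ Set.Ioo (0 : ℝ) 1) {f : ℕ → L2 n}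
    (hf : ∀ k, MemH1 (f k))
    (hc : ∀ ε > 0, ∃ N, ∀ k ≥ N, ∀ l ≥ N, innerS s (f k - f l) (f k - f l) ≤ ε) :
    ∃ g : L2 n, MemH1 g ∧ Tendsto (fun k => innerS s (f k - g) (f k - g)) atTop (𝓝 0) := by
  have hcauchy : CauchySeq f := by
    rw [Metric.cauchySeq_iff]
    intro ε hε
    obtain ⟨N, hN⟩ := hc (ε ^ 2 / 2) (by positivity)
    refine ⟨N, fun k hk l hl => ?_⟩
    rw [dist_eq_norm]
    have h1 := norm_sq_le_innerS hs ((hf k).sub (hf l))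
    have h2 := hN k hk l hl
    have h3 : ‖f k - f l‖ ^ 2 < ε ^ 2 := by nlinarith [sq_pos_of_pos hε]
    exact lt_of_pow_lt_pow_left₀ 2 hε.le h3
  obtain ⟨g, hg⟩ := cauchySeq_tendsto_of_complete hcauchy
  have hsm := measurable_symbol (n := n) s
  have key : ∀ ε > 0, ∃ N, ∀ k ≥ N, energy s (f k - g) ≤ ENNReal.ofReal ε := by
    intro ε hε
    obtain ⟨N, hN⟩ := hc ε hε
    refine ⟨N, fun k hk => ?_⟩
    have ht : Tendsto (fun l => fourier (f k - f l)) atTop (𝓝 (fourier (f k - g))) := by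
      have hcont : Continuous (fun u : L2 n => fourier u) :=
        (Lp.fourierTransformₗᵢ (Eucl n) ℂ).continuous.comp
          (Complex.ofRealCLM.compLpL 2 (volume : Measure (Eucl n))).continuous
      exact (hcont.tendsto _).comp (tendsto_const_nhds.sub hg)
    obtain ⟨φ, hφ, hae⟩ := (tendstoInMeasure_of_tendsto_Lp ht).exists_seq_tendsto_ae
    calc energy s (f k - g)
        = ∫⁻ ξ, liminf (fun j => ENNReal.ofReal (symbol s ξ) *
            ‖fourier (f k - f (φ j)) ξ‖ₑ ^ 2) atTop := by
          refine lintegral_congr_ae ?_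
          filter_upwards [hae] with ξ hξ
          refine (Tendsto.liminf_eq ?_).symm
          refine ENNReal.Tendsto.const_mul ?_ (Or.inr ENNReal.ofReal_ne_top)
          exact ((ENNReal.continuous_pow 2).tendsto _).comp ((continuous_enorm.tendsto _).comp hξ)
      _ ≤ liminf (fun j => energy s (f k - f (φ j))) atTop :=
          lintegral_liminf_le fun j => by
            have := measurable_fourier (f k - f (φ j))
            fun_prop
      _ ≤ liminf (fun _ : ℕ => ENNReal.ofReal ε) atTop := by
          refine liminf_le_liminf ?_
          filter_upwards [hφ.tendsto_atTop.eventually_ge_atTop N] with j hj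
          have h1 := hN k hk (φ j) hj
          rw [innerS_self] at h1
          exact (ENNReal.le_ofReal_iff_toReal_le
            ((memH1_iff hs _).1 ((hf k).sub (hf _))) hε.le).2 h1
      _ = ENNReal.ofReal ε := by simp
  have hgm : MemH1 g := by
    obtain ⟨N, hN⟩ := key 1 one_pos
    have h1 : MemH1 (f N - g) := (memH1_iff hs _).2
      (ne_top_of_le_ne_top ENNReal.ofReal_ne_top (hN N le_rfl))
    have := (hf N).sub h1
    simpa using this
  refine ⟨g, hgm, ?_⟩
  rw [Metric.tendsto_atTop]
  intro ε hε
  obtain ⟨N, hN⟩ := key (ε / 2) (by positivity)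
  refine ⟨N, fun k hk => ?_⟩
  rw [Real.dist_eq, sub_zero, abs_of_nonneg (innerS_self_nonneg _ _), innerS_self]
  have := ENNReal.toReal_le_of_le_ofReal (by positivity) (hN k hk)
  linarith

lemma heatEnergy_congr {b : ℝ} {u v : Eucl n → ℝ} (h : u =ᵐ[volume] v) :
    heatEnergy b u = heatEnergy b v := by
  unfold heatEnergy
  refine lintegral_congr_ae ?_
  filter_upwards [h] with x hx
  refine lintegral_congr_ae ?_
  filter_upwards [h] with y hy
  rw [hx, hy]

/-- Composition with a reflection, as an operator on `L²(ℝⁿ)`. -/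
def reflectL2 {e : Eucl n} (he : ‖e‖ = 1) (c : ℝ) : L2 n →ₗ[ℝ] L2 n :=
  Lp.compMeasurePreservingₗ ℝ (hreflect e c) (measurePreserving_hreflect he c)

lemma coeFn_reflectL2 {e : Eucl n} (he : ‖e‖ = 1) (c : ℝ) (u : L2 n) :
    reflectL2 he c u =ᵐ[volume] fun x => u (hreflect e c x) :=
  Lp.coeFn_compMeasurePreserving u (measurePreserving_hreflect he c)

lemma reflectL2_reflectL2 {e : Eucl n} (he : ‖e‖ = 1) (c : ℝ) (u : L2 n) :
    reflectL2 he c (reflectL2 he c u) = u := by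
  ext1
  have h := (measurePreserving_hreflect he c).quasiMeasurePreserving.ae_eq_comp
    (coeFn_reflectL2 he c u)
  filter_upwards [coeFn_reflectL2 he c (reflectL2 he c u), h] with x h1 h2
  rw [h1]
  refine h2.trans ?_
  simp [hreflect_hreflect he]

lemma norm_reflectL2 {e : Eucl n} (he : ‖e‖ = 1) (c : ℝ) (u : L2 n) :
    ‖reflectL2 he c u‖ = ‖u‖ :=
  Lp.norm_compMeasurePreserving u (measurePreserving_hreflect he c)

lemma heatEnergy_reflectL2 {e : Eucl n} (he : ‖e‖ = 1) (c b : ℝ) (u : L2 n) :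
    heatEnergy b (reflectL2 he c u) = heatEnergy b u := by
  have hu := measurable_coe u
  rw [heatEnergy_congr (coeFn_reflectL2 he c u)]
  unfold heatEnergy
  have hm : Measurable fun x => ∫⁻ y, ENNReal.ofReal (Real.exp (-b * ‖x - y‖ ^ 2)) *
      ‖u x - u y‖ₑ ^ 2 :=
    Measurable.lintegral_prod_right' (f := fun q : Eucl n × Eucl n =>
      ENNReal.ofReal (Real.exp (-b * ‖q.1 - q.2‖ ^ 2)) * ‖u q.1 - u q.2‖ₑ ^ 2) (by fun_prop)
  rw [← (measurePreserving_hreflect he c).lintegral_comp hm]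
  refine lintegral_congr fun x => ?_
  rw [← (measurePreserving_hreflect he c).lintegral_comp
    (f := fun y => ENNReal.ofReal (Real.exp (-b * ‖hreflect e c x - y‖ ^ 2)) *
      ‖u (hreflect e c x) - u y‖ₑ ^ 2) (by fun_prop)]
  refine lintegral_congr fun y => ?_
  rw [norm_hreflect_sub he]

lemma energy_reflectL2 {s : ℝ} (hs : s ∈ Set.Ioo (0 : ℝ) 1) {e : Eucl n} (he : ‖e‖ = 1) (c : ℝ)
    (u : L2 n) : energy s (reflectL2 he c u) = energy s u :=
  le_antisymm
    (energy_mono hs (norm_reflectL2 he c u) fun b _ => (heatEnergy_reflectL2 he c b u).le)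
    (energy_mono hs (norm_reflectL2 he c u).symm fun b _ => (heatEnergy_reflectL2 he c b u).ge)

lemma MemH1.reflectL2 {u : L2 n} (hu : MemH1 u) {e : Eucl n} (he : ‖e‖ = 1) (c : ℝ) :
    MemH1 (reflectL2 he c u) := by
  have hs : (1 / 2 : ℝ) ∈ Set.Ioo (0 : ℝ) 1 := by norm_num
  rw [memH1_iff hs, energy_reflectL2 hs, ← memH1_iff hs]
  exact hu

lemma innerS_add_self {s : ℝ} (hs : s ∈ Set.Ioo (0 : ℝ) 1) {u v : L2 n} (hu : MemH1 u)
    (hv : MemH1 v) :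
    innerS s (u + v) (u + v) = innerS s u u + 2 * innerS s u v + innerS s v v := by
  rw [innerS_add_left hs hu hv (hu.add hv), innerS_comm u, innerS_comm v,
    innerS_add_left hs hu hv hu, innerS_add_left hs hu hv hv, innerS_comm v u]
  ring

lemma innerS_reflectL2 {s : ℝ} (hs : s ∈ Set.Ioo (0 : ℝ) 1) {e : Eucl n} (he : ‖e‖ = 1) (c : ℝ)
    {u v : L2 n} (hu : MemH1 u) (hv : MemH1 v) :
    innerS s (reflectL2 he c u) (reflectL2 he c v) = innerS s u v := by
  have hself : ∀ w : L2 n, innerS s (reflectL2 he c w) (reflectL2 he c w) = innerS s w w := fun w => by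
    rw [innerS_self, innerS_self, energy_reflectL2 hs]
  have h1 := innerS_add_self hs hu hv
  have h2 := innerS_add_self hs (hu.reflectL2 he c) (hv.reflectL2 he c)
  rw [← map_add, hself, hself, hself] at h2
  linarith

/-- A form `Q` that is bounded below relative to `N`, negative somewhere, and nonnegative on the
kernel of a functional controlling its negative part attains its bottom: no compactness is
needed, since minimizing sequences normalized by the functional are Cauchy. -/
theorem exists_negative_eigenvector {V : Type*} [AddCommGroup V] [Module ℝ V]
    (S N Q : LinearMap.BilinForm ℝ V) (ℓ : V →ₗ[ℝ] ℝ) (hNs : ∀ x y, N x y = N y x)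
    (hQs : ∀ x y, Q x y = Q y x)
    (hN : ∀ x, 0 ≤ N x x) (hN0 : ∀ x, N x x = 0 → x = 0) (hNS : ∀ x, N x x ≤ S x x)
    {M C K : ℝ} (hC : 0 ≤ C)
    (hQS : ∀ x, |Q x x| ≤ M * S x x) (hℓ : ∀ x, (ℓ x) ^ 2 ≤ M * S x x)
    (hco : ∀ x, S x x ≤ 2 * Q x x + C * N x x) (hker : ∀ x, ℓ x = 0 → 0 ≤ Q x x)
    (hlow : ∀ x, -K * (ℓ x) ^ 2 ≤ Q x x) {x₀ : V} (hx₀ : Q x₀ x₀ < 0)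
    (hcomplete : ∀ f : ℕ → V, (∀ ε > 0, ∃ m, ∀ k ≥ m, ∀ l ≥ m, S (f k - f l) (f k - f l) ≤ ε) →
      ∃ g, Tendsto (fun k => S (f k - g) (f k - g)) atTop (𝓝 0)) :
    ∃ μ < 0, ∃ x ≠ 0, ∀ y, Q x y = μ * N x y := by
  have hsq : ∀ (B : LinearMap.BilinForm ℝ V) (a : ℝ) (x : V), B (a • x) (a • x) = a ^ 2 * B x x := by
    intro B a x; simp; ring
  set I : Set ℝ := {t | ∃ x, N x x = 1 ∧ Q x x = t} with hI
  have hbdd : BddBelow I := ⟨-C / 2, by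
    rintro _ ⟨x, hx, rfl⟩
    have h1 := hco x
    have h2 := hNS x
    rw [hx] at *
    linarith⟩
  have hx₀0 : x₀ ≠ 0 := by rintro rfl; simp at hx₀
  have hNpos : ∀ x, x ≠ 0 → 0 < N x x := fun x hx =>
    lt_of_le_of_ne (hN x) fun h => hx (hN0 x h.symm)
  have hnormal : ∀ x, x ≠ 0 → Q x x / N x x ∈ I := by
    intro x hx
    have hp := hNpos x hx
    refine ⟨(Real.sqrt (N x x))⁻¹ • x, ?_, ?_⟩
    · rw [hsq, inv_pow, Real.sq_sqrt hp.le, inv_mul_cancel₀ hp.ne']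
    · rw [hsq, inv_pow, Real.sq_sqrt hp.le]; field_simp
  set μ := sInf I with hμ
  have hμneg : μ < 0 :=
    lt_of_le_of_lt (csInf_le hbdd (hnormal x₀ hx₀0)) (div_neg_of_neg_of_pos hx₀ (hNpos x₀ hx₀0))
  have hμle : ∀ x, μ * N x x ≤ Q x x := by
    intro x
    by_cases hx : x = 0
    · simp [hx]
    · rw [← le_div_iff₀ (hNpos x hx)]
      exact csInf_le hbdd (hnormal x hx)
  set P : LinearMap.BilinForm ℝ V := Q - μ • N with hP
  have hPapp : ∀ x y, P x y = Q x y - μ * N x y := fun x y => by simp [hP]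
  have hPnn : ∀ x, 0 ≤ P x x := fun x => by rw [hPapp]; linarith [hμle x]
  have hPs : LinearMap.IsSymm P := ⟨fun x y => by
    rw [RingHom.id_apply, hPapp, hPapp, hQs, hNs]⟩
  have hPsub : ∀ x y, P (x - y) (x - y) ≤ 2 * P x x + 2 * P y y := by
    intro x y
    have := hPnn (x + y)
    simp only [map_add, map_sub, LinearMap.add_apply, LinearMap.sub_apply] at *
    linarith
  have hchoose : ∀ k : ℕ, ∃ y, ℓ y = 1 ∧ P y y ≤ K * (1 / ((k : ℝ) + 1)) := by
    intro k
    have hkpos : (0 : ℝ) < 1 / ((k : ℝ) + 1) := by positivity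
    have hk1 : 1 / ((k : ℝ) + 1) ≤ 1 := by
      rw [div_le_one (by positivity)]; linarith [(Nat.cast_nonneg k : (0 : ℝ) ≤ k)]
    obtain ⟨_, ⟨x, hx1, rfl⟩, hxlt⟩ := exists_lt_of_csInf_lt
      (⟨_, hnormal x₀ hx₀0⟩ : I.Nonempty)
      (show sInf I < μ + (-μ / 2) * (1 / ((k : ℝ) + 1)) by
        rw [← hμ]; nlinarith)
    have hl := hlow x
    have hQx : Q x x < μ / 2 := by nlinarith
    have hlpos : -μ / 2 ≤ K * (ℓ x) ^ 2 := by linarith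
    have hl0 : ℓ x ≠ 0 := by
      intro h; rw [h] at hlpos; nlinarith
    refine ⟨(ℓ x)⁻¹ • x, by simp [hl0], ?_⟩
    have hl2 : 0 < (ℓ x) ^ 2 := by positivity
    rw [hsq, inv_pow, inv_mul_le_iff₀ hl2, hPapp, hx1]
    calc Q x x - μ * 1 ≤ (-μ / 2) * (1 / ((k : ℝ) + 1)) := by linarith
      _ ≤ (K * (ℓ x) ^ 2) * (1 / ((k : ℝ) + 1)) := by gcongr
      _ = _ := by ring
  choose y hy1 hyP using hchoose
  have hSw : ∀ w, ℓ w = 0 → S w w ≤ (2 + C / (-μ)) * P w w := by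
    intro w hw
    have h1 := hker w hw
    have h2 := hco w
    have h3 := hPapp w w
    have h4 := hN w
    have h5 : N w w ≤ P w w / (-μ) := by
      rw [le_div_iff₀ (by linarith)]; linarith
    have h6 : C * N w w ≤ C * (P w w / (-μ)) := by gcongr
    have h7 : 2 * Q w w ≤ 2 * P w w := by nlinarith
    calc S w w ≤ 2 * P w w + C * (P w w / (-μ)) := by linarith
      _ = _ := by ring
  have hD : 0 < 2 + C / (-μ) := by
    have : 0 ≤ C / (-μ) := div_nonneg hC (by linarith)
    linarith
  have htz : Tendsto (fun k : ℕ => K * (1 / ((k : ℝ) + 1))) atTop (𝓝 0) := by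
    simpa using (tendsto_one_div_add_atTop_nhds_zero_nat (𝕜 := ℝ)).const_mul K
  obtain ⟨g, hg⟩ := hcomplete y (by
    intro ε hε
    obtain ⟨m, hm⟩ := (htz.eventually (gt_mem_nhds
      (show (0 : ℝ) < ε / (4 * (2 + C / (-μ))) by positivity))).exists_forall_of_atTop
    refine ⟨m, fun k hk l hl => ?_⟩
    refine (hSw _ (by rw [map_sub, hy1, hy1, sub_self])).trans ?_
    have h1 := hPsub (y k) (y l)
    have h2 := hyP k
    have h3 := hyP l
    have h4 := hm k hk
    have h5 := hm l hl
    calc _ ≤ (2 + C / (-μ)) * (4 * (ε / (4 * (2 + C / (-μ))))) := by gcongr; linarith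
      _ = ε := by rw [mul_div_assoc', mul_div_assoc', div_eq_iff (by positivity)]; ring)
  have hℓg : ℓ g = 1 := by
    have h1 : (1 - ℓ g) ^ 2 ≤ 0 := by
      refine ge_of_tendsto' (f := fun k => M * S (y k - g) (y k - g)) (x := atTop)
        (by simpa using hg.const_mul M) fun k => ?_
      have := hℓ (y k - g)
      rwa [map_sub, hy1] at this
    nlinarith [sq_nonneg (1 - ℓ g)]
  have hPg : P g g = 0 := by
    refine le_antisymm ?_ (hPnn g)
    have hlim : Tendsto (fun k : ℕ => 2 * (K * (1 / ((k : ℝ) + 1))) +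
        2 * ((M + (-μ)) * S (y k - g) (y k - g))) atTop (𝓝 0) := by
      simpa using (htz.const_mul 2).add ((hg.const_mul (M + (-μ))).const_mul 2)
    refine ge_of_tendsto' hlim fun k => ?_
    have h1 := hPsub (y k) (y k - g)
    rw [sub_sub_cancel] at h1
    have h2 := hyP k
    have h3 : P (y k - g) (y k - g) ≤ (M + (-μ)) * S (y k - g) (y k - g) := by
      rw [hPapp]
      have h4 := (le_abs_self _).trans (hQS (y k - g))
      have h5 := hNS (y k - g)
      nlinarith
    linarith
  refine ⟨μ, hμneg, g, ?_, fun z => ?_⟩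
  · rintro rfl; simp at hℓg
  · have h1 := P.apply_sq_le_of_symm hPnn hPs g z
    rw [hPg, zero_mul] at h1
    have h2 : P g z = 0 := by nlinarith [sq_nonneg (P g z)]
    rw [hPapp] at h2
    linarith

/-- A function invariant under all reflections in hyperplanes through `x₀` is radial. -/
theorem isRadialAbout_of_reflect (x₀ : Eucl n) (f : L2 n)
    (h : ∀ (e : Eucl n) (_ : ‖e‖ = 1),
      (fun x => f (hreflect e (inner ℝ e x₀) x)) =ᵐ[volume] f) : IsRadialAbout x₀ f := by
  set A : ℕ → Eucl n → ℝ := fun k x => ⨍ y in Metric.closedBall x (1 / ((k : ℝ) + 1)), f y with hA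
  have hloc : LocallyIntegrable f (volume : Measure (Eucl n)) :=
    (Lp.memLp f).locallyIntegrable (by norm_num)
  have hlim : ∀ᵐ x : Eucl n, Tendsto (fun k => A k x) atTop (𝓝 (f x)) := by
    filter_upwards [IsUnifLocDoublingMeasure.ae_tendsto_average volume hloc 1] with x hx
    refine hx (fun _ : ℕ => x) (fun k => 1 / ((k : ℝ) + 1)) ?_ ?_
    · refine tendsto_nhdsWithin_iff.2 ⟨tendsto_one_div_add_atTop_nhds_zero_nat, ?_⟩
      exact Eventually.of_forall fun k => by simp only [Set.mem_Ioi]; positivity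
    · exact Eventually.of_forall fun k => by
        simp only [Metric.mem_closedBall, dist_self]; positivity
  have hinv : ∀ x y : Eucl n, ‖x - x₀‖ = ‖y - x₀‖ → ∀ k, A k x = A k y := by
    intro x y hxy k
    by_cases hne : x = y
    · rw [hne]
    have hpos : 0 < ‖x - y‖ := norm_pos_iff.2 (sub_ne_zero.2 hne)
    set e : Eucl n := (‖x - y‖)⁻¹ • (x - y) with he
    have he1 : ‖e‖ = 1 := by
      rw [he, norm_smul, norm_inv, norm_norm, inv_mul_cancel₀ hpos.ne']
    have hxe : x - y = ‖x - y‖ • e := by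
      rw [he, smul_smul, mul_inv_cancel₀ hpos.ne', one_smul]
    set c := inner ℝ e x₀ with hc
    have hσ : hreflect e c x = y := by
      have h1 : 2 * (inner ℝ e x - c) = ‖x - y‖ := by
        have h2 : 2 * inner ℝ (x - y) (x - x₀) = ‖x - y‖ ^ 2 := by
          have h3 : ‖(x - x₀) - (x - y)‖ ^ 2 = ‖y - x₀‖ ^ 2 := by congr 2; abel
          rw [norm_sub_sq_real, hxy, real_inner_comm] at h3
          linarith
        rw [hc, ← inner_sub_right, he, real_inner_smul_left]
        have : 2 * ((‖x - y‖)⁻¹ * inner ℝ (x - y) (x - x₀)) =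
          (‖x - y‖)⁻¹ * (2 * inner ℝ (x - y) (x - x₀)) := by ring
        rw [this, h2]; field_simp
      unfold hreflect
      rw [h1, ← hxe]; abel
    have hpre : hreflect e c ⁻¹' (Metric.closedBall y (1 / ((k : ℝ) + 1))) =
        Metric.closedBall x (1 / ((k : ℝ) + 1)) := by
      ext z
      rw [Set.mem_preimage, Metric.mem_closedBall, Metric.mem_closedBall, dist_eq_norm,
        dist_eq_norm, ← hσ, norm_hreflect_sub he1]
    have hint : ∫ z in Metric.closedBall x (1 / ((k : ℝ) + 1)), f z =
        ∫ z in Metric.closedBall y (1 / ((k : ℝ) + 1)), f z := by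
      rw [← (measurePreserving_hreflect he1 c).setIntegral_preimage_emb
        (measurableEmbedding_hreflect he1 c) f (Metric.closedBall y _), hpre]
      exact setIntegral_congr_ae Metric.isClosed_closedBall.measurableSet
        ((h e he1).mono fun z hz _ => hz.symm)
    have hvol : volume.real (Metric.closedBall x (1 / ((k : ℝ) + 1))) =
        volume.real (Metric.closedBall y (1 / ((k : ℝ) + 1))) := by
      rw [Measure.real, Measure.real, ← hpre, (measurePreserving_hreflect he1 c).measure_preimage
        Metric.isClosed_closedBall.measurableSet.nullMeasurableSet]
    simp only [hA]
    rw [setAverage_eq, setAverage_eq, hint, hvol]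
  classical
  refine ⟨fun r => if hr : ∃ x, Tendsto (fun k => A k x) atTop (𝓝 (f x)) ∧ ‖x - x₀‖ = r
    then f hr.choose else 0, ?_⟩
  filter_upwards [hlim] with x hx
  have hr : ∃ y, Tendsto (fun k => A k y) atTop (𝓝 (f y)) ∧ ‖y - x₀‖ = ‖x - x₀‖ := ⟨x, hx, rfl⟩
  rw [dif_pos hr]
  refine tendsto_nhds_unique hx ?_
  refine hr.choose_spec.1.congr fun k => ?_
  exact hinv _ _ hr.choose_spec.2 k

lemma integral_rpow_mul_sq_le {α : Type*} {mα : MeasurableSpace α} {μ : Measure α} {p : ℝ}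
    (hp : 0 < p) {f g : α → ℝ} (hf : AEStronglyMeasurable f μ) (hg : AEStronglyMeasurable g μ)
    (hfi : Integrable (fun x => |f x| ^ (p + 2)) μ) (hgi : Integrable (fun x => |g x| ^ (p + 2)) μ) :
    ∫ x, |f x| ^ p * (g x) ^ 2 ∂μ ≤
      (∫ x, |f x| ^ (p + 2) ∂μ) ^ (p / (p + 2)) * (∫ x, |g x| ^ (p + 2) ∂μ) ^ (2 / (p + 2)) := by
  have hconj : ((p + 2) / p).HolderConjugate ((p + 2) / 2) := by
    rw [Real.holderConjugate_iff]
    constructor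
    · rw [lt_div_iff₀ hp]; linarith
    · rw [inv_div, inv_div]; field_simp
  have e1 : ∀ x, (|f x| ^ p) ^ ((p + 2) / p) = |f x| ^ (p + 2) := fun x => by
    rw [← Real.rpow_mul (abs_nonneg _)]; congr 1; field_simp
  have e2 : ∀ x, ((g x) ^ 2) ^ ((p + 2) / 2) = |g x| ^ (p + 2) := fun x => by
    rw [← sq_abs, ← Real.rpow_natCast, ← Real.rpow_mul (abs_nonneg _)]; congr 1
    push_cast; field_simp
  have h := integral_mul_le_Lp_mul_Lq_of_nonneg (μ := μ) hconj (f := fun x => |f x| ^ p)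
    (g := fun x => (g x) ^ 2) (ae_of_all _ fun x => by positivity)
    (ae_of_all _ fun x => by positivity) ?_ ?_
  · simp_rw [e1, e2, one_div_div] at h
    exact h
  · rw [← integrable_norm_rpow_iff, ENNReal.toReal_ofReal (by positivity)]
    · refine hfi.congr (ae_of_all _ fun x => ?_)
      simp only
      rw [Real.norm_of_nonneg (by positivity), e1]
    · exact ((continuous_abs.comp_aestronglyMeasurable hf).aemeasurable.pow_const p).aestronglyMeasurable
    · rw [Ne, ENNReal.ofReal_eq_zero, not_le]; positivity
    · exact ENNReal.ofReal_ne_top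
  · rw [← integrable_norm_rpow_iff, ENNReal.toReal_ofReal (by positivity)]
    · refine hgi.congr (ae_of_all _ fun x => ?_)
      simp only
      rw [Real.norm_of_nonneg (by positivity), e2]
    · exact hg.pow 2
    · rw [Ne, ENNReal.ofReal_eq_zero, not_le]; positivity
    · exact ENNReal.ofReal_ne_top

lemma rpow_mul_mul_le {p a b c : ℝ} (hp : 0 < p) (ha : 0 ≤ a) (hb : 0 ≤ b) (hc : 0 ≤ c) :
    a ^ p * (b * c) ≤ a ^ (p + 2) + b ^ (p + 2) + c ^ (p + 2) := by
  set m := max a (max b c) with hm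
  have h1 : a ≤ m := le_max_left _ _
  have h2 : b ≤ m := (le_max_left _ _).trans (le_max_right _ _)
  have h3 : c ≤ m := (le_max_right _ _).trans (le_max_right _ _)
  have hm0 : 0 ≤ m := ha.trans h1
  have h4 : a ^ p * (b * c) ≤ m ^ (p + 2) := by
    rw [Real.rpow_add_of_nonneg hm0 hp.le (by norm_num), Real.rpow_two, sq]
    gcongr
  have ha' : 0 ≤ a ^ (p + 2) := by positivity
  have hb' : 0 ≤ b ^ (p + 2) := by positivity
  have hc' : 0 ≤ c ^ (p + 2) := by positivity
  refine h4.trans ?_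
  rcases max_choice a (max b c) with h | h
  · rw [hm, h]; linarith
  · rcases max_choice b c with h' | h'
    · rw [hm, h, h']; linarith
    · rw [hm, h, h']; linarith

lemma two_mul_rpow_le_add {q : ℝ} (hq : 1 ≤ q) (a h : ℝ) :
    2 * |a| ^ q ≤ |a + h| ^ q + |a - h| ^ q := by
  have h1 : |a| ≤ (1 / 2 : ℝ) * |a + h| + (1 / 2 : ℝ) * |a - h| := by
    have := abs_add_le (a + h) (a - h)
    rw [show a + h + (a - h) = 2 * a by ring, abs_mul, abs_two] at this
    linarith
  have h2 := (convexOn_rpow hq).2 (Set.mem_Ici.2 (abs_nonneg (a + h)))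
    (Set.mem_Ici.2 (abs_nonneg (a - h))) (show (0 : ℝ) ≤ 1 / 2 by norm_num)
    (show (0 : ℝ) ≤ 1 / 2 by norm_num) (by norm_num)
  simp only [smul_eq_mul] at h2
  have h3 := Real.rpow_le_rpow (z := q) (abs_nonneg a) h1 (by linarith)
  linarith

/-- The symmetric second difference quotient of `|·|^q` at a positive point. -/
lemma tendsto_second_difference {a : ℝ} (ha : 0 < a) (h q : ℝ) :
    Tendsto (fun t : ℝ => (|a + t * h| ^ q + |a - t * h| ^ q - 2 * |a| ^ q) / t ^ 2) (𝓝[>] 0)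
      (𝓝 (q * (q - 1) * a ^ (q - 2) * h ^ 2)) := by
  have hc1 : Tendsto (fun t : ℝ => a + t * h) (𝓝 0) (𝓝 a) := by
    have : Continuous fun t : ℝ => a + t * h := by fun_prop
    simpa using this.tendsto 0
  have hc2 : Tendsto (fun t : ℝ => a - t * h) (𝓝 0) (𝓝 a) := by
    have : Continuous fun t : ℝ => a - t * h := by fun_prop
    simpa using this.tendsto 0
  have p1 : ∀ᶠ t : ℝ in 𝓝[>] 0, 0 < a + t * h :=
    (hc1.mono_left nhdsWithin_le_nhds).eventually (lt_mem_nhds ha)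
  have p2 : ∀ᶠ t : ℝ in 𝓝[>] 0, 0 < a - t * h :=
    (hc2.mono_left nhdsWithin_le_nhds).eventually (lt_mem_nhds ha)
  have main : Tendsto (fun t : ℝ => ((a + t * h) ^ q + (a - t * h) ^ q - 2 * a ^ q) / t ^ 2) (𝓝[>] 0)
      (𝓝 (q * (q - 1) * a ^ (q - 2) * h ^ 2)) := by
    have d1 : ∀ t : ℝ, HasDerivAt (fun t : ℝ => a + t * h) h t := fun t => by
      simpa using ((hasDerivAt_id t).mul_const h).const_add a
    have d2 : ∀ t : ℝ, HasDerivAt (fun t : ℝ => a - t * h) (-h) t := fun t => by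
      simpa using ((hasDerivAt_id t).mul_const h).const_sub a
    refine HasDerivAt.lhopital_zero_nhdsGT
      (f' := fun t => h * q * (a + t * h) ^ (q - 1) + (-h) * q * (a - t * h) ^ (q - 1))
      (g' := fun t => 2 * t) ?_ ?_ ?_ ?_ ?_ ?_
    · filter_upwards [p1, p2] with t h1 h2
      exact (((d1 t).rpow_const (Or.inl h1.ne')).add ((d2 t).rpow_const (Or.inl h2.ne'))).sub_const _
    · exact Eventually.of_forall fun t => by simpa using hasDerivAt_pow 2 t
    · filter_upwards [self_mem_nhdsWithin] with t ht
      have : (0 : ℝ) < t := ht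
      positivity
    · have h1 := hc1.rpow_const (p := q) (Or.inl ha.ne')
      have h2 := hc2.rpow_const (p := q) (Or.inl ha.ne')
      have h3 := ((h1.add h2).sub_const (2 * a ^ q)).mono_left (nhdsWithin_le_nhds (s := Set.Ioi 0))
      rwa [show a ^ q + a ^ q - 2 * a ^ q = 0 by ring] at h3
    · have : Tendsto (fun t : ℝ => t ^ 2) (𝓝 0) (𝓝 (0 ^ 2)) := (continuous_pow 2).tendsto 0
      rw [zero_pow two_ne_zero] at this
      exact this.mono_left nhdsWithin_le_nhds
    · have e1 : HasDerivAt (fun t : ℝ => h * q * (a + t * h) ^ (q - 1) +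
          (-h) * q * (a - t * h) ^ (q - 1)) (h * q * (h * (q - 1) * a ^ (q - 1 - 1)) +
          (-h) * q * ((-h) * (q - 1) * a ^ (q - 1 - 1))) 0 := by
        have f1 := ((d1 0).rpow_const (p := q - 1) (Or.inl (by simpa using ha.ne'))).const_mul (h * q)
        have f2 := ((d2 0).rpow_const (p := q - 1) (Or.inl (by simpa using ha.ne'))).const_mul (-h * q)
        have f3 := f1.fun_add f2
        simpa using f3
      have e2 := (e1.tendsto_slope_zero_right).div_const 2
      rw [show (h * q * (h * (q - 1) * a ^ (q - 1 - 1)) +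
          (-h) * q * ((-h) * (q - 1) * a ^ (q - 1 - 1))) / 2 = q * (q - 1) * a ^ (q - 2) * h ^ 2 by
        rw [show q - 1 - 1 = q - 2 by ring]; ring] at e2
      refine e2.congr' ?_
      filter_upwards [self_mem_nhdsWithin] with t ht
      have : (0 : ℝ) < t := ht
      simp only [zero_add, zero_mul, add_zero, sub_zero, smul_eq_mul]
      field_simp
      ring
  refine main.congr' ?_
  filter_upwards [p1, p2] with t h1 h2
  rw [abs_of_pos h1, abs_of_pos h2, abs_of_pos ha]

variable {s p : ℝ} {u : L2 n}

lemma integral_rpow_ground (hp : 0 < p) (hu : IsGroundState s p u) :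
    ∫ x, |u x| ^ (p + 2) = innerS s u u := by
  rw [hu.solution.2 u hu.solution.1]
  refine integral_congr_ae ?_
  filter_upwards [hu.nonneg] with x hx
  rw [abs_of_nonneg hx, show p + 2 = (p + 1) + 1 by ring,
    Real.rpow_add_one' hx (by linarith)]

lemma innerS_ground_pos (hs : s ∈ Set.Ioo (0 : ℝ) 1) (hu : IsGroundState s p u) :
    0 < innerS s u u := innerS_self_pos hs hu.solution.1 hu.ne_zero

lemma lam_eq (hp : 0 < p) (hu : IsGroundState s p u) :
    lam n s p = innerS s u u / (innerS s u u) ^ (2 / (p + 2)) := by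
  rw [← hu.least_energy, J, integral_rpow_ground hp hu]

lemma lam_pos (hs : s ∈ Set.Ioo (0 : ℝ) 1) (hp : 0 < p) (hu : IsGroundState s p u) :
    0 < lam n s p := by
  have := innerS_ground_pos hs hu
  rw [lam_eq hp hu]; positivity

lemma lam_le_J {v : L2 n} (hv : MemH1 v) (h0 : v ≠ 0) : lam n s p ≤ J s p v := by
  refine csInf_le ⟨0, ?_⟩ ⟨v, hv, h0, rfl⟩
  rintro _ ⟨w, -, -, rfl⟩
  refine div_nonneg (innerS_self_nonneg s w) (Real.rpow_nonneg (integral_nonneg fun x => ?_) _)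
  positivity

/-- The Sobolev embedding implied by the positivity of `λ_s`. -/
lemma sobolev (hs : s ∈ Set.Ioo (0 : ℝ) 1) (hp : 0 < p) (hu : IsGroundState s p u) {v : L2 n}
    (hv : MemH1 v) : Integrable (fun x => |v x| ^ (p + 2)) ∧
      lam n s p * (∫ x, |v x| ^ (p + 2)) ^ (2 / (p + 2)) ≤ innerS s v v := by
  have hpos := lam_pos hs hp hu
  by_cases h0 : v = 0
  · have hz : (fun x => |v x| ^ (p + 2)) =ᵐ[volume] fun _ => (0 : ℝ) := by
      rw [h0]
      filter_upwards [Lp.coeFn_zero ℝ 2 (volume : Measure (Eucl n))] with x hx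
      rw [hx]; simp [Real.zero_rpow (show p + 2 ≠ 0 by linarith)]
    refine ⟨(integrable_zero _ _ _).congr hz.symm, ?_⟩
    rw [integral_congr_ae hz]
    simp only [integral_zero]
    rw [Real.zero_rpow (by positivity), mul_zero]
    exact innerS_self_nonneg s v
  · have hJ := lam_le_J (s := s) (p := p) hv h0
    have hne : ∫ x, |v x| ^ (p + 2) ≠ 0 := by
      intro h
      rw [J, h, Real.zero_rpow (by positivity), div_zero] at hJ
      linarith
    have hi : 0 < ∫ x, |v x| ^ (p + 2) :=
      lt_of_le_of_ne (integral_nonneg fun x => by positivity) hne.symm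
    refine ⟨by_contra fun h => hne (integral_undef h), ?_⟩
    rw [J, le_div_iff₀ (by positivity)] at hJ
    exact hJ

lemma integral_rpow_le (hs : s ∈ Set.Ioo (0 : ℝ) 1) (hp : 0 < p) (hu : IsGroundState s p u)
    {v : L2 n} (hv : MemH1 v) :
    ∫ x, |v x| ^ (p + 2) ≤ (innerS s v v / lam n s p) ^ ((p + 2) / 2) := by
  have hpos := lam_pos hs hp hu
  have h1 := (sobolev hs hp hu hv).2
  have hi : 0 ≤ ∫ x, |v x| ^ (p + 2) := integral_nonneg fun x => by positivity
  rw [mul_comm, ← le_div_iff₀ hpos] at h1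
  have h2 := Real.rpow_le_rpow (by positivity) h1 (show 0 ≤ (p + 2) / 2 by positivity)
  rwa [← Real.rpow_mul hi, show 2 / (p + 2) * ((p + 2) / 2) = 1 by field_simp,
    Real.rpow_one] at h2

lemma integrable_potential (hs : s ∈ Set.Ioo (0 : ℝ) 1) (hp : 0 < p) (hu : IsGroundState s p u)
    {φ ψ : L2 n} (hφ : MemH1 φ) (hψ : MemH1 ψ) :
    Integrable (fun x => u x ^ p * (φ x * ψ x)) := by
  have hmu := measurable_coe u
  have hmφ := measurable_coe φ
  have hmψ := measurable_coe ψ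
  refine (((sobolev hs hp hu hu.solution.1).1.add (sobolev hs hp hu hφ).1).add
    (sobolev hs hp hu hψ).1).mono' (Measurable.aestronglyMeasurable (by fun_prop)) ?_
  filter_upwards [hu.nonneg] with x hx
  rw [norm_mul, norm_mul, Real.norm_of_nonneg (by positivity), Real.norm_eq_abs, Real.norm_eq_abs]
  have := rpow_mul_mul_le hp (abs_nonneg (u x)) (abs_nonneg (φ x)) (abs_nonneg (ψ x))
  rw [abs_of_nonneg hx] at this
  simpa [abs_of_nonneg hx] using this

/-- The second variation of `J_s` at a ground state is nonnegative. -/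
theorem linForm_nonneg (hs : s ∈ Set.Ioo (0 : ℝ) 1) (hp : 0 < p) (hu : IsGroundState s p u)
    {φ : L2 n} (hφ : MemH1 φ) (horth : innerS s u φ = 0) : 0 ≤ linForm s p u φ φ := by
  have huH := hu.solution.1
  set A := innerS s u u with hA
  set N := innerS s φ φ with hN
  have hApos : 0 < A := innerS_ground_pos hs hu
  have hNnn : 0 ≤ N := innerS_self_nonneg s φ
  have hl := lam_pos hs hp hu
  set q := p + 2 with hq
  have hq2 : 2 < q := by linarith
  have hmu := measurable_coe u
  have hmφ := measurable_coe φ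
  have hIu := (sobolev hs hp hu huH).1
  have hvar : ∀ t : ℝ, Integrable (fun x => |u x + t * φ x| ^ q) ∧
      ∫ x, |u x + t * φ x| ^ q ≤ ((A + t ^ 2 * N) / lam n s p) ^ (q / 2) := by
    intro t
    have hv : MemH1 (u + t • φ) := huH.add (hφ.smul t)
    have hae : (fun x => |(u + t • φ : L2 n) x| ^ q) =ᵐ[volume] fun x => |u x + t * φ x| ^ q := by
      filter_upwards [Lp.coeFn_add u (t • φ), Lp.coeFn_smul t φ] with x h1 h2
      rw [h1, Pi.add_apply, h2]; rfl
    have hS : innerS s (u + t • φ) (u + t • φ) = A + t ^ 2 * N := by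
      rw [innerS_add_self hs huH (hφ.smul t), innerS_comm u (t • φ), innerS_smul_left,
        innerS_comm φ u, horth, innerS_smul_left, innerS_comm φ, innerS_smul_left, ← hA, ← hN]
      ring
    refine ⟨(sobolev hs hp hu hv).1.congr hae, ?_⟩
    rw [← integral_congr_ae hae, ← hS]
    exact integral_rpow_le hs hp hu hv
  set B : ℝ → ℝ := fun r => ((A + r * N) / lam n s p) ^ (q / 2) with hB
  have hlam : lam n s p = A / A ^ (2 / q) := lam_eq hp hu
  have hAl : A / lam n s p = A ^ (2 / q) := by
    rw [hlam]
    have : 0 < A ^ (2 / q) := by positivity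
    field_simp
  have hB0 : B 0 = A := by
    simp only [hB, zero_mul, add_zero]
    rw [hAl, ← Real.rpow_mul hApos.le, show 2 / q * (q / 2) = 1 by field_simp, Real.rpow_one]
  have hBd : HasDerivAt B (q / 2 * N) 0 := by
    have h1 : HasDerivAt (fun r : ℝ => (A + r * N) / lam n s p) (N / lam n s p) 0 := by
      simpa using (((hasDerivAt_id (0 : ℝ)).mul_const N).const_add A).div_const (lam n s p)
    have h2 := h1.rpow_const (p := q / 2) (Or.inl (by simp only [zero_mul, add_zero]; positivity))
    convert h2 using 1
    simp only [zero_mul, add_zero]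
    rw [Real.rpow_sub_one (by positivity), hAl, ← Real.rpow_mul hApos.le,
      show 2 / q * (q / 2) = 1 by field_simp, Real.rpow_one, ← hAl]
    field_simp
  set τ : ℕ → ℝ := fun k => 1 / ((k : ℝ) + 1) with hτ
  have hτpos : ∀ k, 0 < τ k := fun k => by simp only [hτ]; positivity
  have hτlim : Tendsto τ atTop (𝓝[>] 0) :=
    tendsto_nhdsWithin_iff.2 ⟨tendsto_one_div_add_atTop_nhds_zero_nat,
      Eventually.of_forall fun k => hτpos k⟩
  have hτ2 : Tendsto (fun k => τ k ^ 2) atTop (𝓝[>] 0) := by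
    refine tendsto_nhdsWithin_iff.2 ⟨?_, Eventually.of_forall fun k => sq_pos_of_pos (hτpos k)⟩
    simpa using (tendsto_nhdsWithin_iff.1 hτlim).1.pow 2
  set F : ℕ → Eucl n → ℝ := fun k x =>
    (|u x + τ k * φ x| ^ q + |u x - τ k * φ x| ^ q - 2 * |u x| ^ q) / (τ k) ^ 2 with hF
  have hFnn : ∀ k x, 0 ≤ F k x := fun k x => by
    have := two_mul_rpow_le_add (show 1 ≤ q by linarith) (u x) (τ k * φ x)
    exact div_nonneg (by linarith) (by positivity)
  have hFint : ∀ k, Integrable (F k) ∧ ∫ x, F k x ≤ 2 * ((τ k ^ 2)⁻¹ * (B (0 + τ k ^ 2) - B 0)) := by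
    intro k
    have h1 := hvar (τ k)
    have h2 := hvar (-τ k)
    simp only [neg_mul, ← sub_eq_add_neg, neg_sq] at h2
    refine ⟨((h1.1.add h2.1).sub (hIu.const_mul 2)).div_const _, ?_⟩
    simp only [hF]
    rw [integral_div, integral_sub (f := fun x => |u x + τ k * φ x| ^ q + |u x - τ k * φ x| ^ q)
      (h1.1.add h2.1) (hIu.const_mul 2), integral_add h1.1 h2.1,
      integral_const_mul, integral_rpow_ground hp hu, hB0, zero_add, ← hA]
    rw [div_eq_inv_mul, mul_left_comm]
    refine mul_le_mul_of_nonneg_left ?_ (by positivity)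
    have := h1.2
    have := h2.2
    simp only [hB]
    linarith
  have hFatou : ∫⁻ x, ENNReal.ofReal (q * (q - 1) * (u x ^ p * (φ x * φ x))) ≤
      ENNReal.ofReal (q * N) := by
    calc ∫⁻ x, ENNReal.ofReal (q * (q - 1) * (u x ^ p * (φ x * φ x)))
        ≤ ∫⁻ x, liminf (fun k => ENNReal.ofReal (F k x)) atTop := by
          refine lintegral_mono_ae ?_
          filter_upwards [hu.nonneg] with x hx
          rcases hx.eq_or_lt with h0 | h0
          · rw [← h0, Real.zero_rpow hp.ne']; simp
          · have ht := ENNReal.tendsto_ofReal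
              ((tendsto_second_difference h0 (φ x) q).comp hτlim)
            have := ht.liminf_eq
            simp only [Function.comp_def] at this
            simp only [hF]
            rw [this, show q - 2 = p by rw [hq]; ring]
            refine le_of_eq ?_
            congr 1; ring
      _ ≤ liminf (fun k => ∫⁻ x, ENNReal.ofReal (F k x)) atTop :=
          lintegral_liminf_le fun k => by simp only [hF]; fun_prop
      _ ≤ liminf (fun k => ENNReal.ofReal (2 * ((τ k ^ 2)⁻¹ * (B (0 + τ k ^ 2) - B 0)))) atTop := by
          refine liminf_le_liminf (Eventually.of_forall fun k => ?_)
          rw [← ofReal_integral_eq_lintegral_ofReal (hFint k).1 (ae_of_all _ fun x => hFnn k x)]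
          exact ENNReal.ofReal_le_ofReal (hFint k).2
      _ = ENNReal.ofReal (q * N) := by
          refine Tendsto.liminf_eq (ENNReal.tendsto_ofReal ?_)
          have := ((hBd.tendsto_slope_zero_right).comp hτ2).const_mul 2
          rw [show 2 * (q / 2 * N) = q * N by ring] at this
          exact this
  have hpot := integrable_potential hs hp hu hφ hφ
  rw [← ofReal_integral_eq_lintegral_ofReal (hpot.const_mul _), integral_const_mul,
    ENNReal.ofReal_le_ofReal_iff (by positivity)] at hFatou
  · unfold linForm
    have h1 : q * ((q - 1) * ∫ x, u x ^ p * (φ x * φ x)) ≤ q * N := by linarith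
    have h2 := le_of_mul_le_mul_left h1 (by linarith)
    rw [show q - 1 = p + 1 by rw [hq]; ring] at h2
    linarith
  · filter_upwards [hu.nonneg] with x hx
    have : 0 ≤ φ x * φ x := mul_self_nonneg _
    have h1 : 0 ≤ u x ^ p := by positivity
    exact mul_nonneg (mul_nonneg (by linarith) (by linarith)) (mul_nonneg h1 this)

/-- A ground state and its reflection in a hyperplane are ordered on each side of it. -/
theorem ordered_ground (hs : s ∈ Set.Ioo (0 : ℝ) 1) (hp : 0 < p) (hu : IsGroundState s p u)
    {e : Eucl n} (he : ‖e‖ = 1) (c : ℝ) :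
    (∀ᵐ x ∂(volume.restrict (halfSpace e c)), u (hreflect e c x) ≤ u x) ∨
    (∀ᵐ x ∂(volume.restrict (halfSpace e c)), u x ≤ u (hreflect e c x)) := by
  have hmu := measurable_coe u
  have huH := hu.solution.1
  have hmp := measurable_polarize e c hmu
  have hmem : MemLp (polarize e c u) 2 volume := by
    refine ((Lp.memLp u).norm.add ((Lp.memLp u).comp_measurePreserving
      (measurePreserving_hreflect he c)).norm).mono' hmp.aestronglyMeasurable
      (ae_of_all _ fun x => ?_)
    simp only [Pi.add_apply, Function.comp_apply, Real.norm_eq_abs]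
    unfold polarize
    have h1 := abs_nonneg (u x)
    have h2 := abs_nonneg (u (hreflect e c x))
    split_ifs
    · exact abs_max_le_max_abs_abs.trans (max_le (by linarith) (by linarith))
    · exact abs_min_le_max_abs_abs.trans (max_le (by linarith) (by linarith))
  set v : L2 n := hmem.toLp with hv
  have hvae : v =ᵐ[volume] polarize e c u := hmem.coeFn_toLp
  have hnorm : ‖v‖ = ‖u‖ := by
    have h1 : ‖v‖ₑ ^ 2 = ‖u‖ₑ ^ 2 := by
      rw [← lintegral_enorm_sq_eq, ← lintegral_enorm_sq_eq,
        ← lintegral_comp_polarize he c hmu (f := fun r => ‖r‖ₑ ^ 2) (by fun_prop)]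
      exact lintegral_congr_ae (hvae.mono fun x hx => by simp only; rw [hx])
    have h2 := congrArg ENNReal.toReal h1
    simp only [ENNReal.toReal_pow, toReal_enorm] at h2
    exact (sq_eq_sq₀ (norm_nonneg _) (norm_nonneg _)).1 h2
  have hheat : ∀ b > 0, heatEnergy b v ≤ heatEnergy b u := fun b hb => by
    rw [heatEnergy_congr hvae]; exact heatEnergy_polarize_le he c hb hmu
  have hle := energy_mono hs hnorm hheat
  have hufin := (memH1_iff hs u).1 huH
  have hvH : MemH1 v := (memH1_iff hs v).2 (ne_top_of_le_ne_top hufin hle)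
  have hv0 : v ≠ 0 := by
    rw [← norm_ne_zero_iff, hnorm, norm_ne_zero_iff]; exact hu.ne_zero
  have hpow : ∫ x, |v x| ^ (p + 2) = ∫ x, |u x| ^ (p + 2) := by
    have hmv := measurable_coe v
    rw [integral_eq_lintegral_of_nonneg_ae (ae_of_all _ fun x => by positivity)
      (Measurable.aestronglyMeasurable (by fun_prop)),
      integral_eq_lintegral_of_nonneg_ae (ae_of_all _ fun x => by positivity)
      (Measurable.aestronglyMeasurable (by fun_prop)),
      ← lintegral_comp_polarize he c hmu (f := fun r => ENNReal.ofReal (|r| ^ (p + 2))) (by fun_prop)]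
    congr 1
    exact lintegral_congr_ae (hvae.mono fun x hx => by simp only; rw [hx])
  have hge : innerS s u u ≤ innerS s v v := by
    have h1 := lam_le_J (s := s) (p := p) hvH hv0
    rw [← hu.least_energy, J, J, hpow, integral_rpow_ground hp hu] at h1
    have hA := innerS_ground_pos hs hu
    exact (div_le_div_iff_of_pos_right (by positivity)).1 h1
  have heq : energy s v = energy s u := by
    refine le_antisymm hle ?_
    rw [innerS_self, innerS_self] at hge
    exact (ENNReal.toReal_le_toReal hufin ((memH1_iff hs v).1 hvH)).1 hge
  obtain ⟨b, hb, hbe⟩ := exists_heatEnergy_eq hs huH hnorm hheat heq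
  rw [heatEnergy_congr hvae] at hbe
  exact ordered_of_heatEnergy_polarize_eq he hb hmu (heatEnergy_ne_top hb u) hbe

/-- The hyperplane `{x | ⟨e, x⟩ = c}` splits the `L²` mass of `u` evenly. -/
def Bisects (u : L2 n) (e : Eucl n) (c : ℝ) : Prop :=
  ∫⁻ x in halfSpace e c, ‖u x‖ₑ ^ 2 = ∫⁻ x in halfSpace e c, ‖u (hreflect e c x)‖ₑ ^ 2

lemma eq_reflect_of_bisects (hs : s ∈ Set.Ioo (0 : ℝ) 1) (hp : 0 < p) (hu : IsGroundState s p u)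
    {e : Eucl n} (he : ‖e‖ = 1) {c : ℝ} (hb : Bisects u e c) :
    (fun x => u (hreflect e c x)) =ᵐ[volume] u := by
  have hmu := measurable_coe u
  have hfin : ∫⁻ x in halfSpace e c, ‖u x‖ₑ ^ 2 ≠ ∞ := by
    refine ne_top_of_le_ne_top ?_ (setLIntegral_le_lintegral _ _)
    rw [lintegral_enorm_sq_eq]; simp
  have hnn := hu.nonneg
  have hnn' := (measurePreserving_hreflect he c).quasiMeasurePreserving.ae hu.nonneg
  have hmono : ∀ a b : ℝ, 0 ≤ a → a ≤ b → ‖a‖ₑ ^ 2 ≤ ‖b‖ₑ ^ 2 := fun a b ha hab => by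
    rw [Real.enorm_of_nonneg ha, Real.enorm_of_nonneg (ha.trans hab)]
    gcongr
  have hinj : ∀ a b : ℝ, 0 ≤ a → 0 ≤ b → ‖a‖ₑ ^ 2 = ‖b‖ₑ ^ 2 → a = b := fun a b ha hb h => by
    have := congrArg ENNReal.toReal h
    simp only [ENNReal.toReal_pow, toReal_enorm, Real.norm_of_nonneg ha,
      Real.norm_of_nonneg hb] at this
    exact (sq_eq_sq₀ ha hb).1 this
  have hH : ∀ᵐ x ∂(volume.restrict (halfSpace e c)), u (hreflect e c x) = u x := by
    rcases ordered_ground hs hp hu he c with h | h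
    · have := ae_eq_of_ae_le_of_lintegral_le (f := fun x => ‖u (hreflect e c x)‖ₑ ^ 2)
        (g := fun x => ‖u x‖ₑ ^ 2) (by
          filter_upwards [h, ae_restrict_of_ae hnn'] with x h1 h2
          exact hmono _ _ h2 h1) (hb ▸ hfin) (by fun_prop) hb.le
      filter_upwards [this, ae_restrict_of_ae hnn, ae_restrict_of_ae hnn'] with x h1 h2 h3
      exact hinj _ _ h3 h2 h1
    · have := ae_eq_of_ae_le_of_lintegral_le (f := fun x => ‖u x‖ₑ ^ 2)
        (g := fun x => ‖u (hreflect e c x)‖ₑ ^ 2) (by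
          filter_upwards [h, ae_restrict_of_ae hnn] with x h1 h2
          exact hmono _ _ h2 h1) hfin (by fun_prop) hb.ge
      filter_upwards [this, ae_restrict_of_ae hnn, ae_restrict_of_ae hnn'] with x h1 h2 h3
      exact (hinj _ _ h2 h3 h1).symm
  rw [ae_restrict_iff' (measurableSet_halfSpace e c)] at hH
  filter_upwards [hH, (measurePreserving_hreflect he c).quasiMeasurePreserving.ae hH,
    ae_inner_ne he c] with x h1 h2 h3
  rcases lt_or_gt_of_ne h3 with h4 | h4
  · have h5 : hreflect e c x ∈ halfSpace e c := by
      change c < inner ℝ e (hreflect e c x)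
      rw [inner_hreflect he]; linarith
    have := h2 h5
    rw [hreflect_hreflect he] at this
    exact this.symm
  · exact h1 h4

lemma exists_bisects (u : L2 n) (h0 : u ≠ 0) {e : Eucl n} (he : ‖e‖ = 1) :
    ∃ c, Bisects u e c := by
  have hmu := measurable_coe u
  have hint : Integrable (fun x => (u x) ^ 2) := (Lp.memLp u).integrable_sq
  have hTpos : 0 < ∫ x, (u x) ^ 2 := by
    have h1 : ENNReal.ofReal (∫ x, (u x) ^ 2) = ‖u‖ₑ ^ 2 := by
      rw [ofReal_integral_eq_lintegral_ofReal hint (ae_of_all _ fun x => sq_nonneg _),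
        ← lintegral_enorm_sq_eq]
      refine lintegral_congr fun x => ?_
      rw [← ofReal_norm, ← ENNReal.ofReal_pow (norm_nonneg _), Real.norm_eq_abs, sq_abs]
    rw [← ENNReal.ofReal_pos, h1]
    have : 0 < ‖u‖ₑ := by rw [enorm_pos]; exact h0
    positivity
  set T := ∫ x, (u x) ^ 2 with hT
  set G : ℝ → ℝ := fun c => ∫ x, (halfSpace e c).indicator (fun x => (u x) ^ 2) x with hG
  have hmeas : ∀ c, AEStronglyMeasurable ((halfSpace e c).indicator (fun x => (u x) ^ 2)) volume :=
    fun c => (Measurable.indicator (by fun_prop) (measurableSet_halfSpace e c)).aestronglyMeasurable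
  have hbd : ∀ c, ∀ᵐ x : Eucl n, ‖(halfSpace e c).indicator (fun x => (u x) ^ 2) x‖ ≤ (u x) ^ 2 :=
    fun c => ae_of_all _ fun x => by
      refine (norm_indicator_le_norm_self _ _).trans ?_
      rw [Real.norm_of_nonneg (sq_nonneg _)]
  have hcont : Continuous G := by
    rw [continuous_iff_continuousAt]
    intro c₀
    refine tendsto_integral_filter_of_dominated_convergence (fun x => (u x) ^ 2)
      (Eventually.of_forall hmeas) (Eventually.of_forall hbd) hint ?_
    filter_upwards [ae_inner_ne he c₀] with x hx
    refine tendsto_const_nhds.congr' ?_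
    rcases lt_or_gt_of_ne hx with h | h
    · filter_upwards [lt_mem_nhds h] with c hc
      rw [Set.indicator_of_notMem (show x ∉ halfSpace e c₀ from not_lt.2 h.le),
        Set.indicator_of_notMem (show x ∉ halfSpace e c from not_lt.2 (le_of_lt hc))]
    · filter_upwards [gt_mem_nhds h] with c hc
      rw [Set.indicator_of_mem (show x ∈ halfSpace e c₀ from h),
        Set.indicator_of_mem (show x ∈ halfSpace e c from hc)]
  have htop : Tendsto G atTop (𝓝 0) := by
    have := tendsto_integral_filter_of_dominated_convergence (μ := volume) (l := atTop)
      (F := fun (c : ℝ) x => (halfSpace e c).indicator (fun x => (u x) ^ 2) x) (f := fun _ => 0)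
      (fun x => (u x) ^ 2) (Eventually.of_forall hmeas) (Eventually.of_forall hbd) hint
      (ae_of_all _ fun x => by
        refine tendsto_const_nhds.congr' ?_
        filter_upwards [eventually_ge_atTop (inner ℝ e x)] with c hc
        rw [Set.indicator_of_notMem (show x ∉ halfSpace e c from not_lt.2 hc)])
    simpa using this
  have hbot : Tendsto G atBot (𝓝 T) := by
    refine tendsto_integral_filter_of_dominated_convergence (μ := volume) (l := atBot)
      (fun x => (u x) ^ 2) (Eventually.of_forall hmeas) (Eventually.of_forall hbd) hint
      (ae_of_all _ fun x => by
        refine tendsto_const_nhds.congr' ?_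
        filter_upwards [eventually_lt_atBot (inner ℝ e x)] with c hc
        rw [Set.indicator_of_mem (show x ∈ halfSpace e c from hc)])
  obtain ⟨c₁, hc₁⟩ := (htop.eventually (gt_mem_nhds (show 0 < T / 2 by linarith))).exists
  obtain ⟨c₂, hc₂⟩ := (hbot.eventually (lt_mem_nhds (show T / 2 < T by linarith))).exists
  obtain ⟨c, hc⟩ := mem_range_of_exists_le_of_exists_ge hcont ⟨c₁, hc₁.le⟩ ⟨c₂, hc₂.le⟩
  refine ⟨c, ?_⟩
  have hsq : ∀ x, ENNReal.ofReal ((u x) ^ 2) = ‖u x‖ₑ ^ 2 := fun x => by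
    rw [← ofReal_norm, ← ENNReal.ofReal_pow (norm_nonneg _), Real.norm_eq_abs, sq_abs]
  have h1 : ∫⁻ x in halfSpace e c, ‖u x‖ₑ ^ 2 = ENNReal.ofReal (T / 2) := by
    rw [← hc]
    simp only [hG]
    rw [integral_indicator (measurableSet_halfSpace e c), ofReal_integral_eq_lintegral_ofReal
      hint.integrableOn (ae_of_all _ fun x => sq_nonneg _)]
    simp_rw [hsq]
  have h2 : ∫⁻ x, ‖u x‖ₑ ^ 2 = ENNReal.ofReal (T / 2) + ENNReal.ofReal (T / 2) := by
    rw [← ENNReal.ofReal_add (by linarith) (by linarith), add_halves, hT,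
      ofReal_integral_eq_lintegral_ofReal hint (ae_of_all _ fun x => sq_nonneg _)]
    simp_rw [hsq]
  rw [lintegral_eq_halfSpace he c (by fun_prop), lintegral_add_left (by fun_prop), h1] at h2
  unfold Bisects
  rw [h1]
  exact ((ENNReal.add_right_inj ENNReal.ofReal_ne_top).1 h2).symm

/-- Reflection of the coordinates in `T` about the corresponding coordinates of `x₀`. -/
def flipCoords (x₀ : Eucl n) (T : Finset (Fin n)) (x : Eucl n) : Eucl n :=
  WithLp.toLp 2 fun i => if i ∈ T then 2 * x₀ i - x i else x i

lemma flipCoords_insert (x₀ : Eucl n) {T : Finset (Fin n)} {j : Fin n} (hj : j ∉ T) :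
    flipCoords x₀ (insert j T) =
      hreflect (EuclideanSpace.single j 1) (x₀ j) ∘ flipCoords x₀ T := by
  funext x
  ext i
  simp only [flipCoords, Function.comp_apply, hreflect, Finset.mem_insert]
  by_cases hij : i = j
  · subst hij
    simp [hj, EuclideanSpace.inner_single_left]
    ring
  · simp [hij]

lemma flipCoords_invariant (x₀ : Eucl n)
    (h : ∀ j, (fun x => u (hreflect (EuclideanSpace.single j 1) (x₀ j) x)) =ᵐ[volume] u)
    (T : Finset (Fin n)) :
    MeasurePreserving (flipCoords x₀ T) (volume : Measure (Eucl n)) volume ∧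
      (fun x => u (flipCoords x₀ T x)) =ᵐ[volume] u := by
  induction T using Finset.induction_on with
  | empty =>
    have : flipCoords x₀ ∅ = id := by
      funext x; ext i; simp [flipCoords]
    rw [this]
    exact ⟨MeasurePreserving.id _, EventuallyEq.rfl⟩
  | insert j T hj ih =>
    rw [flipCoords_insert x₀ hj]
    refine ⟨(measurePreserving_hreflect (by simp) _).comp ih.1, ?_⟩
    exact (ih.1.quasiMeasurePreserving.ae_eq_comp (h j)).trans ih.2

/-- Ground states are invariant under all reflections in hyperplanes through a suitable point. -/
theorem exists_center (hs : s ∈ Set.Ioo (0 : ℝ) 1) (hp : 0 < p) (hu : IsGroundState s p u) :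
    ∃ x₀ : Eucl n, ∀ (e : Eucl n) (_ : ‖e‖ = 1),
      (fun x => u (hreflect e (inner ℝ e x₀) x)) =ᵐ[volume] u := by
  have hmu := measurable_coe u
  have hcoord : ∀ j : Fin n, ∃ c, Bisects u (EuclideanSpace.single j 1) c := fun j =>
    exists_bisects u hu.ne_zero (by simp)
  choose c hc using hcoord
  set x₀ : Eucl n := WithLp.toLp 2 c with hx₀
  have hcen := flipCoords_invariant (u := u) x₀
    (fun j => eq_reflect_of_bisects hs hp hu (by simp) (hc j)) Finset.univ
  have hflip : flipCoords x₀ Finset.univ = fun x => (2 : ℝ) • x₀ - x := by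
    funext x; ext i; simp [flipCoords]
  rw [hflip] at hcen
  refine ⟨x₀, fun e he => eq_reflect_of_bisects hs hp hu he ?_⟩
  set a := inner ℝ e x₀ with ha
  have hσ := measurePreserving_hreflect he a
  have hκ : MeasurePreserving (fun x => (2 : ℝ) • x₀ - hreflect e a x)
    (volume : Measure (Eucl n)) volume := hcen.1.comp hσ
  have hpre : (fun x => (2 : ℝ) • x₀ - hreflect e a x) ⁻¹' (halfSpace e a) = halfSpace e a := by
    ext x
    change a < inner ℝ e ((2 : ℝ) • x₀ - hreflect e a x) ↔ a < inner ℝ e x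
    rw [inner_sub_right, inner_smul_right, inner_hreflect he, ← ha]
    constructor <;> intro h <;> linarith
  have h1 := hκ.setLIntegral_comp_preimage (measurableSet_halfSpace e a)
    (f := fun x => ‖u x‖ₑ ^ 2) (by fun_prop)
  rw [hpre] at h1
  unfold Bisects
  rw [← h1]
  refine lintegral_congr_ae (ae_restrict_of_ae ?_)
  filter_upwards [hσ.quasiMeasurePreserving.ae_eq_comp hcen.2] with x hx
  simp only [Function.comp_apply] at hx
  rw [hx]

lemma potential_add_left (hs : s ∈ Set.Ioo (0 : ℝ) 1) (hp : 0 < p) (hu : IsGroundState s p u)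
    {φ ψ χ : L2 n} (hφ : MemH1 φ) (hψ : MemH1 ψ) (hχ : MemH1 χ) :
    ∫ x, u x ^ p * ((φ + ψ : L2 n) x * χ x) =
      (∫ x, u x ^ p * (φ x * χ x)) + ∫ x, u x ^ p * (ψ x * χ x) := by
  rw [← integral_add (integrable_potential hs hp hu hφ hχ) (integrable_potential hs hp hu hψ hχ)]
  refine integral_congr_ae ?_
  filter_upwards [Lp.coeFn_add φ ψ] with x hx
  rw [hx, Pi.add_apply]; ring

lemma potential_smul_left (c : ℝ) (φ χ : L2 n) :
    ∫ x, u x ^ p * ((c • φ : L2 n) x * χ x) = c * ∫ x, u x ^ p * (φ x * χ x) := by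
  rw [← integral_const_mul]
  refine integral_congr_ae ?_
  filter_upwards [Lp.coeFn_smul c φ] with x hx
  rw [hx, Pi.smul_apply, smul_eq_mul]; ring

lemma linForm_comm (φ ψ : L2 n) : linForm s p u φ ψ = linForm s p u ψ φ := by
  unfold linForm
  rw [innerS_comm]
  simp_rw [mul_comm (φ _) (ψ _)]

lemma linForm_add_left (hs : s ∈ Set.Ioo (0 : ℝ) 1) (hp : 0 < p) (hu : IsGroundState s p u)
    {φ ψ χ : L2 n} (hφ : MemH1 φ) (hψ : MemH1 ψ) (hχ : MemH1 χ) :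
    linForm s p u (φ + ψ) χ = linForm s p u φ χ + linForm s p u ψ χ := by
  unfold linForm
  rw [innerS_add_left hs hφ hψ hχ, potential_add_left hs hp hu hφ hψ hχ]
  ring

lemma linForm_smul_left (c : ℝ) (φ χ : L2 n) :
    linForm s p u (c • φ) χ = c * linForm s p u φ χ := by
  unfold linForm
  rw [innerS_smul_left, potential_smul_left]
  ring

/-- The form of the linearized operator as a bilinear form on `H¹(ℝⁿ)`. -/
def linBilin (hs : s ∈ Set.Ioo (0 : ℝ) 1) (hp : 0 < p) (hu : IsGroundState s p u) :
    LinearMap.BilinForm ℝ (H1 n) :=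
  LinearMap.mk₂ ℝ (fun φ ψ => linForm s p u (φ : L2 n) ψ)
    (fun φ ψ χ => linForm_add_left hs hp hu φ.2 ψ.2 χ.2)
    (fun c φ ψ => linForm_smul_left c _ _)
    (fun φ ψ χ => by
      simp only [linForm_comm (φ : L2 n)]
      exact linForm_add_left hs hp hu ψ.2 χ.2 φ.2)
    (fun c φ ψ => by
      simp only [linForm_comm (φ : L2 n)]
      exact linForm_smul_left c _ _)

/-- The `L²` scalar product as a bilinear form on `H¹(ℝⁿ)`. -/
def massForm (n : ℕ) : LinearMap.BilinForm ℝ (H1 n) :=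
  (innerₗ (L2 n)).domRestrict₁₂ (H1 n) (H1 n)

lemma linForm_ground_left (hp : 0 < p) (hu : IsGroundState s p u) {φ : L2 n} (hφ : MemH1 φ) :
    linForm s p u u φ = -p * innerS s u φ := by
  have h : ∫ x, u x ^ p * (u x * φ x) = innerS s u φ := by
    rw [hu.solution.2 φ hφ]
    refine integral_congr_ae ?_
    filter_upwards [hu.nonneg] with x hx
    rw [Real.rpow_add_one' hx (by linarith)]; ring
  unfold linForm
  rw [h]; ring

lemma linForm_ground_neg (hs : s ∈ Set.Ioo (0 : ℝ) 1) (hp : 0 < p) (hu : IsGroundState s p u) :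
    linForm s p u u u < 0 := by
  rw [linForm_ground_left hp hu hu.solution.1]
  have := mul_pos hp (innerS_ground_pos hs hu)
  linarith

lemma potential_nonneg (hu : IsGroundState s p u) (φ : L2 n) :
    0 ≤ ∫ x, u x ^ p * (φ x * φ x) := by
  refine integral_nonneg_of_ae ?_
  filter_upwards [hu.nonneg] with x hx
  have : 0 ≤ φ x * φ x := mul_self_nonneg _
  simp only [Pi.zero_apply]
  positivity

lemma setIntegral_potential_le (hs : s ∈ Set.Ioo (0 : ℝ) 1) (hp : 0 < p) (hu : IsGroundState s p u)
    {φ : L2 n} (hφ : MemH1 φ) (T : Set (Eucl n)) :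
    ∫ x in T, u x ^ p * (φ x * φ x) ≤
      (∫ x in T, |u x| ^ (p + 2)) ^ (p / (p + 2)) * (innerS s φ φ / lam n s p) := by
  have hl := lam_pos hs hp hu
  have hIu := (sobolev hs hp hu hu.solution.1).1
  obtain ⟨hIφ, hS⟩ := sobolev hs hp hu hφ
  calc ∫ x in T, u x ^ p * (φ x * φ x) = ∫ x in T, |u x| ^ p * (φ x) ^ 2 := by
        refine integral_congr_ae (ae_restrict_of_ae ?_)
        filter_upwards [hu.nonneg] with x hx
        rw [abs_of_nonneg hx, sq]
    _ ≤ (∫ x in T, |u x| ^ (p + 2)) ^ (p / (p + 2)) *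
          (∫ x in T, |φ x| ^ (p + 2)) ^ (2 / (p + 2)) :=
        integral_rpow_mul_sq_le hp (measurable_coe u).aestronglyMeasurable
          (measurable_coe φ).aestronglyMeasurable hIu.integrableOn hIφ.integrableOn
    _ ≤ _ := by
        refine mul_le_mul_of_nonneg_left ?_
          (Real.rpow_nonneg (integral_nonneg fun x => by positivity) _)
        rw [le_div_iff₀ hl, mul_comm]
        refine le_trans (mul_le_mul_of_nonneg_left ?_ hl.le) hS
        refine Real.rpow_le_rpow (integral_nonneg fun x => by positivity) ?_ (by positivity)
        exact setIntegral_le_integral hIφ (ae_of_all _ fun x => by positivity)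

lemma inner_self_eq_integral (φ : L2 n) : inner ℝ φ φ = ∫ x, φ x * φ x := by
  rw [L2.inner_def]
  rfl

/-- The potential `u^p` is infinitesimally form bounded. -/
lemma exists_potential_bound (hs : s ∈ Set.Ioo (0 : ℝ) 1) (hp : 0 < p) (hu : IsGroundState s p u) :
    ∃ C, 0 ≤ C ∧ ∀ φ : L2 n, MemH1 φ →
      innerS s φ φ ≤ 2 * linForm s p u φ φ + C * inner ℝ φ φ := by
  have hl := lam_pos hs hp hu
  have hmu := measurable_coe u
  have hIu := (sobolev hs hp hu hu.solution.1).1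
  set T : ℕ → Set (Eucl n) := fun k => {x | (k : ℝ) < |u x|} with hT
  have hTm : ∀ k, MeasurableSet (T k) := fun k => measurableSet_lt measurable_const (by fun_prop)
  have htail : Tendsto (fun k => ∫ x in T k, |u x| ^ (p + 2)) atTop (𝓝 0) := by
    have h := tendsto_setIntegral_of_antitone (μ := volume) (f := fun x => |u x| ^ (p + 2)) hTm
      (fun k l hkl x hx => lt_of_le_of_lt (Nat.cast_le (α := ℝ).2 hkl) hx) ⟨0, hIu.integrableOn⟩
    have hempty : ⋂ k, T k = ∅ := by
      ext x
      simp only [Set.mem_iInter, Set.mem_empty_iff_false, iff_false, not_forall]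
      obtain ⟨k, hk⟩ := exists_nat_ge |u x|
      exact ⟨k, not_lt.2 hk⟩
    rw [hempty] at h
    simpa using h
  have htail2 : Tendsto (fun k => 2 * (p + 1) / lam n s p *
      (∫ x in T k, |u x| ^ (p + 2)) ^ (p / (p + 2))) atTop (𝓝 0) := by
    have h := (htail.rpow_const (p := p / (p + 2)) (Or.inr (by positivity))).const_mul
      (2 * (p + 1) / lam n s p)
    rwa [Real.zero_rpow (by positivity), mul_zero] at h
  obtain ⟨k, hk⟩ := (htail2.eventually (gt_mem_nhds one_pos)).exists
  refine ⟨2 * (p + 1) * (k : ℝ) ^ p, by positivity, fun φ hφ => ?_⟩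
  have hpot := integrable_potential hs hp hu hφ hφ
  have hsq : Integrable (fun x => φ x * φ x) := by
    simpa [sq] using (Lp.memLp φ).integrable_sq
  have h1 : ∫ x in (T k)ᶜ, u x ^ p * (φ x * φ x) ≤ (k : ℝ) ^ p * inner ℝ φ φ := by
    rw [inner_self_eq_integral, ← integral_const_mul]
    calc ∫ x in (T k)ᶜ, u x ^ p * (φ x * φ x) ≤ ∫ x in (T k)ᶜ, (k : ℝ) ^ p * (φ x * φ x) := by
          refine integral_mono_ae hpot.integrableOn (hsq.const_mul _).integrableOn ?_
          filter_upwards [ae_restrict_mem (hTm k).compl, ae_restrict_of_ae hu.nonneg] with x hx h0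
          have hx' : |u x| ≤ k := not_lt.1 hx
          rw [abs_of_nonneg h0] at hx'
          exact mul_le_mul_of_nonneg_right (Real.rpow_le_rpow h0 hx' hp.le) (mul_self_nonneg _)
      _ ≤ _ := setIntegral_le_integral (hsq.const_mul _)
          (ae_of_all _ fun x => mul_nonneg (by positivity) (mul_self_nonneg _))
  have h2 := setIntegral_potential_le hs hp hu hφ (T k)
  have h3 := integral_add_compl (hTm k) hpot
  have hSnn := innerS_self_nonneg s φ
  have h4 : 2 * (p + 1) * ∫ x in T k, u x ^ p * (φ x * φ x) ≤ innerS s φ φ := by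
    calc 2 * (p + 1) * ∫ x in T k, u x ^ p * (φ x * φ x)
        ≤ 2 * (p + 1) * ((∫ x in T k, |u x| ^ (p + 2)) ^ (p / (p + 2)) *
            (innerS s φ φ / lam n s p)) := by gcongr
      _ = (2 * (p + 1) / lam n s p * (∫ x in T k, |u x| ^ (p + 2)) ^ (p / (p + 2))) *
            innerS s φ φ := by ring
      _ ≤ 1 * innerS s φ φ := by gcongr
      _ = _ := one_mul _
  have h5 : 2 * (p + 1) * ∫ x in (T k)ᶜ, u x ^ p * (φ x * φ x) ≤
      2 * (p + 1) * ((k : ℝ) ^ p * inner ℝ φ φ) := by gcongr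
  unfold linForm
  rw [← h3]
  linarith

/-- The linearized operator at a ground state has a negative eigenvalue. -/
theorem exists_negative_eigenvalue (hs : s ∈ Set.Ioo (0 : ℝ) 1) (hp : 0 < p)
    (hu : IsGroundState s p u) : ∃ μ < 0, ∃ φ : L2 n, IsEigenfunction s p u μ φ := by
  have huH := hu.solution.1
  have hl := lam_pos hs hp hu
  have hA := innerS_ground_pos hs hu
  set A := innerS s u u with hAdef
  set u' : H1 n := ⟨u, huH⟩ with hu'
  obtain ⟨C, hC, hCb⟩ := exists_potential_bound hs hp hu
  set D := (∫ x, |u x| ^ (p + 2)) ^ (p / (p + 2)) / lam n s p with hD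
  have hDnn : 0 ≤ D := div_nonneg (Real.rpow_nonneg (integral_nonneg fun x => by positivity) _) hl.le
  have hpot : ∀ φ : L2 n, MemH1 φ → ∫ x, u x ^ p * (φ x * φ x) ≤ D * innerS s φ φ := by
    intro φ hφ
    have := setIntegral_potential_le hs hp hu hφ Set.univ
    rw [setIntegral_univ, setIntegral_univ] at this
    calc _ ≤ _ := this
      _ = _ := by rw [hD]; ring
  have hlow : ∀ φ : H1 n, -(p / A) * (innerForm hs u' φ) ^ 2 ≤ linBilin hs hp hu φ φ := by
    intro φ
    set a := innerForm hs u' φ / A with ha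
    set w : H1 n := φ - a • u' with hw
    have huw : innerForm hs u' w = 0 := by
      have : innerForm hs u' u' = A := rfl
      rw [hw, map_sub, map_smul, this, smul_eq_mul, ha]; field_simp; ring
    have hQw : 0 ≤ linBilin hs hp hu w w := linForm_nonneg hs hp hu w.2 huw
    have hQu : ∀ ψ : H1 n, linBilin hs hp hu u' ψ = -p * innerForm hs u' ψ := fun ψ =>
      linForm_ground_left hp hu ψ.2
    have hsymm : ∀ ψ χ : H1 n, linBilin hs hp hu ψ χ = linBilin hs hp hu χ ψ := fun ψ χ =>
      linForm_comm _ _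
    have hexp : linBilin hs hp hu φ φ = linBilin hs hp hu w w - p * A * a ^ 2 := by
      have hφ : φ = w + a • u' := by rw [hw]; abel
      have huu : innerForm hs u' u' = A := rfl
      conv_lhs => rw [hφ]
      simp only [map_add, map_smul, LinearMap.add_apply, LinearMap.smul_apply, smul_eq_mul]
      rw [hsymm w u', hQu, hQu, huw, huu]
      ring
    rw [hexp]
    have : -(p / A) * (innerForm hs u' φ) ^ 2 = -(p * A * a ^ 2) := by
      rw [ha]; field_simp
    rw [this]; linarith
  obtain ⟨μ, hμ, φ, hφ0, hφ⟩ := exists_negative_eigenvector (innerForm hs) (massForm n)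
    (linBilin hs hp hu) (innerForm hs u') (M := 1 + (p + 1) * D + A) (C := C) (K := p / A)
    (x₀ := u')
    (fun x y => real_inner_comm (y : L2 n) (x : L2 n))
    (fun x y => linForm_comm _ _)
    (fun x => real_inner_self_nonneg (x := (x : L2 n)))
    (fun x hx => Subtype.ext (inner_self_eq_zero.1 hx))
    (fun x => by
      change inner ℝ (x : L2 n) x ≤ innerS s (x : L2 n) x
      rw [real_inner_self_eq_norm_sq]; exact norm_sq_le_innerS hs x.2)
    hC
    (fun x => by
      change |linForm s p u (x : L2 n) x| ≤ _ * innerS s (x : L2 n) x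
      have h1 := hpot x x.2
      have h2 := potential_nonneg hu (x : L2 n)
      have h3 := innerS_self_nonneg s (x : L2 n)
      have h4 : (p + 1) * ∫ y, u y ^ p * ((x : L2 n) y * (x : L2 n) y) ≤
        (p + 1) * (D * innerS s (x : L2 n) x) := by gcongr
      have h5 : 0 ≤ (p + 1) * ∫ y, u y ^ p * ((x : L2 n) y * (x : L2 n) y) := by positivity
      have h6 : 0 ≤ A * innerS s (x : L2 n) x := by positivity
      have h7 : 0 ≤ (p + 1) * (D * innerS s (x : L2 n) x) := by positivity
      unfold linForm
      rw [abs_le]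
      constructor <;> linarith)
    (fun x => by
      have h1 := (innerForm (n := n) hs).apply_sq_le_of_symm
        (fun y => innerS_self_nonneg s _) ⟨fun y z => innerS_comm _ _⟩ u' x
      refine h1.trans ?_
      have h3 := innerS_self_nonneg s (x : L2 n)
      change A * innerS s (x : L2 n) x ≤ _ * innerS s (x : L2 n) x
      have h7 : 0 ≤ (p + 1) * D := by positivity
      gcongr
      linarith)
    (fun x => hCb x x.2)
    (fun x hx => linForm_nonneg hs hp hu x.2 hx)
    hlow
    (linForm_ground_neg hs hp hu)
    (fun f hf => by
      obtain ⟨g, hg, hlim⟩ := exists_limit_of_cauchy hs (f := fun k => (f k : L2 n))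
        (fun k => (f k).2) hf
      exact ⟨⟨g, hg⟩, hlim⟩)
  refine ⟨μ, hμ, φ, fun h => hφ0 (Subtype.ext h), φ.2, fun ψ hψ => ?_⟩
  rw [real_inner_smul_left]
  exact hφ ⟨ψ, hψ⟩

lemma linForm_self_of_linearizedEq {μ : ℝ} {φ : L2 n} (h : LinearizedEq s p u φ (μ • φ)) :
    linForm s p u φ φ = μ * ‖φ‖ ^ 2 := by
  rw [h.2 φ h.1, real_inner_smul_left, real_inner_self_eq_norm_sq]

/-- No negative eigenfunction is orthogonal to the ground state in the energy product. -/
lemma eq_zero_of_orthogonal (hs : s ∈ Set.Ioo (0 : ℝ) 1) (hp : 0 < p) (hu : IsGroundState s p u)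
    {μ : ℝ} (hμ : μ < 0) {φ : L2 n} (h : LinearizedEq s p u φ (μ • φ))
    (horth : innerS s u φ = 0) : φ = 0 := by
  have h1 := linForm_nonneg hs hp hu h.1 horth
  rw [linForm_self_of_linearizedEq h] at h1
  by_contra h0
  have := norm_pos_iff.2 h0
  nlinarith [sq_pos_of_pos this]

/-- The negative eigenvalue is unique and simple. -/
theorem eigenfunction_unique (hs : s ∈ Set.Ioo (0 : ℝ) 1) (hp : 0 < p) (hu : IsGroundState s p u)
    {μ ν : ℝ} (hμ : μ < 0) (hν : ν < 0) {φ ψ : L2 n} (hφ : IsEigenfunction s p u μ φ)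
    (hψ : IsEigenfunction s p u ν ψ) : ν = μ ∧ ∃ c : ℝ, ψ = c • φ := by
  have hφH := hφ.2.1
  have hψH := hψ.2.1
  have hne : innerS s u φ ≠ 0 := fun h => hφ.1 (eq_zero_of_orthogonal hs hp hu hμ hφ.2 h)
  set c := innerS s u ψ / innerS s u φ with hc
  have hwH : MemH1 (ψ + (-c) • φ) := hψH.add (hφH.smul _)
  have horth : innerS s u (ψ + (-c) • φ) = 0 := by
    rw [innerS_comm, innerS_add_left hs hψH (hφH.smul _) hu.solution.1, innerS_smul_left,
      innerS_comm ψ, innerS_comm φ, hc]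
    field_simp
    ring
  have hQ := linForm_nonneg hs hp hu hwH horth
  have hexp : linForm s p u (ψ + (-c) • φ) (ψ + (-c) • φ) =
      linForm s p u ψ ψ - 2 * c * linForm s p u φ ψ + c ^ 2 * linForm s p u φ φ := by
    rw [linForm_add_left hs hp hu hψH (hφH.smul _) hwH, linForm_smul_left,
      linForm_comm ψ (ψ + (-c) • φ), linForm_comm φ (ψ + (-c) • φ),
      linForm_add_left hs hp hu hψH (hφH.smul _) hψH, linForm_smul_left,
      linForm_add_left hs hp hu hψH (hφH.smul _) hφH, linForm_smul_left, linForm_comm ψ φ]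
    ring
  have hcross1 : linForm s p u φ ψ = μ * inner ℝ φ ψ := by
    rw [hφ.2.2 ψ hψH, real_inner_smul_left]
  have hcross2 : linForm s p u φ ψ = ν * inner ℝ φ ψ := by
    rw [linForm_comm, hψ.2.2 φ hφH, real_inner_smul_left, real_inner_comm]
  rw [hexp, linForm_self_of_linearizedEq hφ.2, linForm_self_of_linearizedEq hψ.2] at hQ
  have hψpos : 0 < ‖ψ‖ ^ 2 := by have := norm_pos_iff.2 hψ.1; positivity
  have hνμ : ν = μ := by
    by_contra hne'
    have h0 : inner ℝ φ ψ = 0 := by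
      have : (ν - μ) * inner ℝ φ ψ = 0 := by linarith
      exact (mul_eq_zero.1 this).resolve_left (sub_ne_zero.2 hne')
    rw [hcross1, h0] at hQ
    have h1 : ν * ‖ψ‖ ^ 2 < 0 := mul_neg_of_neg_of_pos hν hψpos
    have h2 : c ^ 2 * (μ * ‖φ‖ ^ 2) ≤ 0 :=
      mul_nonpos_of_nonneg_of_nonpos (sq_nonneg c)
        (mul_nonpos_of_nonpos_of_nonneg hμ.le (sq_nonneg _))
    linarith
  refine ⟨hνμ, c, ?_⟩
  subst hνμ
  have hw : LinearizedEq s p u (ψ + (-c) • φ) (ν • (ψ + (-c) • φ)) := by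
    refine ⟨hwH, fun χ hχ => ?_⟩
    rw [linForm_add_left hs hp hu hψH (hφH.smul _) hχ, linForm_smul_left, hψ.2.2 χ hχ, hφ.2.2 χ hχ]
    simp only [real_inner_smul_left, inner_add_left]
    ring
  have := eq_zero_of_orthogonal hs hp hu hν hw horth
  rw [neg_smul, ← sub_eq_add_neg, sub_eq_zero] at this
  exact this

lemma linForm_reflectL2 (hs : s ∈ Set.Ioo (0 : ℝ) 1) {e : Eucl n} (he : ‖e‖ = 1) {c : ℝ}
    (hsym : (fun x => u (hreflect e c x)) =ᵐ[volume] u) {φ ψ : L2 n} (hφ : MemH1 φ)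
    (hψ : MemH1 ψ) :
    linForm s p u (reflectL2 he c φ) (reflectL2 he c ψ) = linForm s p u φ ψ := by
  unfold linForm
  rw [innerS_reflectL2 hs he c hφ hψ]
  congr 2
  rw [← (measurePreserving_hreflect he c).integral_comp (measurableEmbedding_hreflect he c)
    (fun x => u x ^ p * (φ x * ψ x))]
  refine integral_congr_ae ?_
  filter_upwards [hsym, coeFn_reflectL2 he c φ, coeFn_reflectL2 he c ψ] with x h1 h2 h3
  rw [h2, h3, h1]

lemma inner_reflectL2 {e : Eucl n} (he : ‖e‖ = 1) (c : ℝ) (φ ψ : L2 n) :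
    inner ℝ (reflectL2 he c φ) (reflectL2 he c ψ) = inner ℝ φ ψ := by
  have h1 := real_inner_eq_norm_add_mul_self_sub_norm_mul_self_sub_norm_mul_self_div_two φ ψ
  have h2 := real_inner_eq_norm_add_mul_self_sub_norm_mul_self_sub_norm_mul_self_div_two
    (reflectL2 he c φ) (reflectL2 he c ψ)
  rw [← map_add, norm_reflectL2, norm_reflectL2, norm_reflectL2] at h2
  rw [h1, h2]

/-- Negative eigenfunctions inherit the reflection symmetries of the ground state. -/
lemma eigenfunction_reflect (hs : s ∈ Set.Ioo (0 : ℝ) 1) (hp : 0 < p) (hu : IsGroundState s p u)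
    {μ : ℝ} (hμ : μ < 0) {φ : L2 n} (hφ : IsEigenfunction s p u μ φ) {e : Eucl n} (he : ‖e‖ = 1)
    {c : ℝ} (hsym : (fun x => u (hreflect e c x)) =ᵐ[volume] u) :
    (fun x => φ (hreflect e c x)) =ᵐ[volume] φ := by
  have hφH := hφ.2.1
  have huT : reflectL2 he c u = u := by
    ext1; exact (coeFn_reflectL2 he c u).trans hsym
  set ψ := reflectL2 he c φ with hψ
  have hψH : MemH1 ψ := hφH.reflectL2 he c
  have hwH : MemH1 (ψ + (-1 : ℝ) • φ) := hψH.add (hφH.smul _)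
  have hw : LinearizedEq s p u (ψ + (-1 : ℝ) • φ) (μ • (ψ + (-1 : ℝ) • φ)) := by
    refine ⟨hwH, fun χ hχ => ?_⟩
    have h1 : linForm s p u ψ χ = μ * inner ℝ ψ χ := by
      have h2 := linForm_reflectL2 (p := p) hs he hsym hφH (hχ.reflectL2 he c)
      rw [reflectL2_reflectL2, hφ.2.2 _ (hχ.reflectL2 he c), real_inner_smul_left,
        ← inner_reflectL2 he c, reflectL2_reflectL2] at h2
      exact h2
    rw [linForm_add_left hs hp hu hψH (hφH.smul _) hχ, linForm_smul_left, h1, hφ.2.2 χ hχ]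
    simp only [real_inner_smul_left, inner_add_left]
    ring
  have horth : innerS s u (ψ + (-1 : ℝ) • φ) = 0 := by
    have h1 := innerS_reflectL2 hs he c hu.solution.1 hφH
    rw [huT, ← hψ] at h1
    rw [innerS_comm, innerS_add_left hs hψH (hφH.smul _) hu.solution.1, innerS_smul_left,
      innerS_comm ψ, innerS_comm φ, h1]
    ring
  have h0 := eq_zero_of_orthogonal hs hp hu hμ hw horth
  have h1 : ψ = φ := by
    rwa [neg_smul, one_smul, ← sub_eq_add_neg, sub_eq_zero] at h0
  have h2 := coeFn_reflectL2 he c φ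
  rw [← hψ, h1] at h2
  exact h2.symm

end MixedSchrodinger

end

theorem propositionA1 (n : ℕ) (hn : 1 ≤ n) (s : ℝ) (hs : s ∈ Set.Ioo (0 : ℝ) 1)
    (p : ℝ) (hp : 0 < p) (hp' : 2 < n → p < 2 * (n : ℝ) / ((n : ℝ) - 2) - 2)
    (u : MixedSchrodinger.L2 n) (hu : MixedSchrodinger.IsGroundState s p u) :
    -- the form is negative at `u` and nonnegative on the `⟨·,·⟩_s`-orthogonal complement of `u`
    MixedSchrodinger.linForm s p u u u < 0 ∧
    (∀ φ : MixedSchrodinger.L2 n, MixedSchrodinger.MemH1 φ → MixedSchrodinger.innerS s u φ = 0 →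
      0 ≤ MixedSchrodinger.linForm s p u φ φ) ∧
    -- exactly one negative eigenvalue, counted with multiplicity, with a radial eigenfunction
    ∃ x₀ : MixedSchrodinger.Eucl n, MixedSchrodinger.IsRadialAbout x₀ u ∧
      ∃ μ : ℝ, μ < 0 ∧ ∃ φ : MixedSchrodinger.L2 n,
        MixedSchrodinger.IsEigenfunction s p u μ φ ∧
        MixedSchrodinger.IsRadialAbout x₀ φ ∧
        ∀ (ν : ℝ) (ψ : MixedSchrodinger.L2 n), ν < 0 →
          MixedSchrodinger.IsEigenfunction s p u ν ψ → ν = μ ∧ ∃ c : ℝ, ψ = c • φ := by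
  obtain ⟨x₀, hx₀⟩ := MixedSchrodinger.exists_center hs hp hu
  obtain ⟨μ, hμ, φ, hφ⟩ := MixedSchrodinger.exists_negative_eigenvalue hs hp hu
  exact ⟨MixedSchrodinger.linForm_ground_neg hs hp hu,
    fun φ hφ h => MixedSchrodinger.linForm_nonneg hs hp hu hφ h,
    x₀, MixedSchrodinger.isRadialAbout_of_reflect x₀ u hx₀, μ, hμ, φ, hφ,
    MixedSchrodinger.isRadialAbout_of_reflect x₀ φ fun e he =>
      MixedSchrodinger.eigenfunction_reflect hs hp hu hμ hφ he (hx₀ e he),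
    fun ν ψ hν hψ => MixedSchrodinger.eigenfunction_unique hs hp hu hμ hν hφ hψ⟩
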